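/- Let $N\ge 1$ be an integer, $s\in(0,1)$ with $2s<N$, $2_s^*=\frac{2N}{N-2s}$, and let $\Omega\subset\mathbb R^N$ be a smooth bounded domain. Let $f:\overline\Omega\times\mathbb R\to\mathbb R$ be continuous, with $f(x,\cdot)\in C^1(\mathbb R)$ for a.e. $x\in\Omega$, put $F(x,t)=\int_0^t f(x,\tau)\,d\tau$, and assume: (H1) there are $q\in(2,2_s^*)$ and $c_1>0$ with $|\partial_t f(x,t)|\le c_1(1+|t|^{q-2})$ for a.e. $x\in\Omega$ and all $t\in\mathbb R$; (H2) $\lim_{t\to0} f(x,t)/t=0$ uniformly for a.e. $x\in\Omega$; (H3) there is $\mu\in(2,2_s^*)$ with $0<\mu F(x,t)\le t f(x,t)$ for a.e. $x\in\Omega$ and all $t\ne0$; (H4) for a.e. $x\in\Omega$, $t\mapsto f(x,t)/t$ is nondecreasing on $(0,\infty)$ and nonincreasing on $(-\infty,0)$. Let $\mathbb H_0^s(\Omega)$ be the space of all $u\in L^2(\mathbb R^N)$ with $u=0$ a.e. in $\mathbb R^N\setminus\Omega$ and $\iint_{\mathbb R^{2N}}\frac{|u(x)-u(y)|^2}{|x-y|^{N+2s}}\,dx\,dy<\infty$,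 with inner product $$\langle u,v\rangle=\iint_{\mathbb R^{2N}}\frac{(u(x)-u(y))(v(x)-v(y))}{|x-y|^{N+2s}}\,dx\,dy$$ and norm $\|u\|=\langle u,u\rangle^{1/2}$. For $\lambda>0$ and $u,v\in\mathbb H_0^s(\Omega)$ let $$I_\lambda(u)=\tfrac12\|u\|^2-\tfrac1{2_s^*}\int_\Omega|u|^{2_s^*}dx-\lambda\int_\Omega F(x,u)\,dx,$$ $$\langle I_\lambda'(u),v\rangle=\langle u,v\rangle-\int_\Omega|u|^{2_s^*-2}uv\,dx-\lambda\int_\Omega f(x,u)v\,dx,$$ let $u^+=\max\{u,0\}$, $u^-=\min\{u,0\}$, and let $$\mathcal M_\lambda=\{u\in\mathbb H_0^s(\Omega):\ \langle I_\lambda'(u),u^+\rangle=\langle I_\lambda'(u),u^-\rangle=0,\ u^+\ne0,\ u^-\ne0\}.$$ Then for every $\lambda>0$ the set $\mathcal M_\lambda$ is nonempty and $I_\lambda$ is bounded below on it, so that $\gamma_\lambda:=\inf_{u\in\mathcal M_\lambda}I_\lambda(u)$ is a real number, and $$\lim_{\lambda\to+\infty}\gamma_\lambda=0.$$ -/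

import Mathlib

open MeasureTheory Filter Topology Set
open scoped ContDiff

noncomputable section

/-- `Ω ⊆ ℝ^N` is a smooth bounded domain: nonempty, open, connected and bounded, and near each
boundary point it is the strict sublevel set `{ρ < 0}` of a smooth function `ρ` whose differential
does not vanish at that point. -/
structure IsSmoothBoundedDomain {N : ℕ} (Ω : Set (EuclideanSpace ℝ (Fin N))) : Prop where
  isOpen : IsOpen Ω
  isConnected : IsConnected Ω
  isBounded : Bornology.IsBounded Ω
  smooth_boundary : ∀ x₀ ∈ frontier Ω, ∃ U : Set (EuclideanSpace ℝ (Fin N)),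
    IsOpen U ∧ x₀ ∈ U ∧ ∃ ρ : EuclideanSpace ℝ (Fin N) → ℝ,
      ContDiffOn ℝ ∞ ρ U ∧ fderiv ℝ ρ x₀ ≠ 0 ∧ Ω ∩ U = {x ∈ U | ρ x < 0}

/-- The fractional critical Sobolev exponent `2N / (N - 2s)`. -/
def critExp (N : ℕ) (s : ℝ) : ℝ := 2 * (N : ℝ) / ((N : ℝ) - 2 * s)

/-- The integrand `(u(x) - u(y)) (v(x) - v(y)) / |x - y|^(N + 2s)` on `ℝ^N × ℝ^N`. -/
def gagliardoIntegrand {N : ℕ} (s : ℝ) (u v : EuclideanSpace ℝ (Fin N) → ℝ)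
    (p : EuclideanSpace ℝ (Fin N) × EuclideanSpace ℝ (Fin N)) : ℝ :=
  (u p.1 - u p.2) * (v p.1 - v p.2) / ‖p.1 - p.2‖ ^ ((N : ℝ) + 2 * s)

/-- The inner product of `H₀ˢ(Ω)`; `gagliardoInner s u u` is the square of its norm, that is, of
the Gagliardo seminorm. -/
def gagliardoInner {N : ℕ} (s : ℝ) (u v : EuclideanSpace ℝ (Fin N) → ℝ) : ℝ :=
  ∫ p : EuclideanSpace ℝ (Fin N) × EuclideanSpace ℝ (Fin N), gagliardoIntegrand s u v p

/-- `Hˢ(ℝ^N) = W^{s,2}(ℝ^N)`, as a set of representatives: square integrable functions with finite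
Gagliardo seminorm. -/
def fracSobolev (N : ℕ) (s : ℝ) : Set (EuclideanSpace ℝ (Fin N) → ℝ) :=
  {u | MemLp u 2 volume ∧ Integrable (gagliardoIntegrand s u u) volume}

/-- `H₀ˢ(Ω)`: the elements of `Hˢ(ℝ^N)` that vanish almost everywhere outside `Ω`. -/
def fracSobolevZero {N : ℕ} (s : ℝ) (Ω : Set (EuclideanSpace ℝ (Fin N))) :
    Set (EuclideanSpace ℝ (Fin N) → ℝ) :=
  {u | u ∈ fracSobolev N s ∧ ∀ᵐ x ∂(volume.restrict Ωᶜ), u x = 0}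

/-- The primitive `F(x,t) = ∫₀ᵗ f(x,τ) dτ`. -/
def primitiveF {N : ℕ} (f : EuclideanSpace ℝ (Fin N) → ℝ → ℝ)
    (x : EuclideanSpace ℝ (Fin N)) (t : ℝ) : ℝ :=
  ∫ τ in (0 : ℝ)..t, f x τ

/-- `u⁺ = max {u, 0}`. -/
def posP {N : ℕ} (u : EuclideanSpace ℝ (Fin N) → ℝ) : EuclideanSpace ℝ (Fin N) → ℝ :=
  fun x => max (u x) 0

/-- `u⁻ = min {u, 0}` (a nonpositive function). -/
def negP {N : ℕ} (u : EuclideanSpace ℝ (Fin N) → ℝ) : EuclideanSpace ℝ (Fin N) → ℝ :=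
  fun x => min (u x) 0

/-- The energy functional `I_λ`. -/
def energy {N : ℕ} (s : ℝ) (Ω : Set (EuclideanSpace ℝ (Fin N)))
    (f : EuclideanSpace ℝ (Fin N) → ℝ → ℝ) (lam : ℝ) (u : EuclideanSpace ℝ (Fin N) → ℝ) : ℝ :=
  1 / 2 * gagliardoInner s u u
    - 1 / critExp N s * (∫ x in Ω, |u x| ^ critExp N s)
    - lam * (∫ x in Ω, primitiveF f x (u x))

/-- The derivative `⟨I_λ'(u), v⟩` of the energy functional. -/
def energyDeriv {N : ℕ} (s : ℝ) (Ω : Set (EuclideanSpace ℝ (Fin N)))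
    (f : EuclideanSpace ℝ (Fin N) → ℝ → ℝ) (lam : ℝ) (u v : EuclideanSpace ℝ (Fin N) → ℝ) : ℝ :=
  gagliardoInner s u v
    - (∫ x in Ω, |u x| ^ (critExp N s - 2) * u x * v x)
    - lam * (∫ x in Ω, f x (u x) * v x)

/-- The set `M_λ` of those `u ∈ H₀ˢ(Ω)` with `u⁺ ≠ 0`, `u⁻ ≠ 0` (as classes modulo a.e. equality)
and `⟨I_λ'(u), u⁺⟩ = ⟨I_λ'(u), u⁻⟩ = 0`. -/
def nodalNehari {N : ℕ} (s : ℝ) (Ω : Set (EuclideanSpace ℝ (Fin N)))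
    (f : EuclideanSpace ℝ (Fin N) → ℝ → ℝ) (lam : ℝ) : Set (EuclideanSpace ℝ (Fin N) → ℝ) :=
  {u | u ∈ fracSobolevZero s Ω ∧
    energyDeriv s Ω f lam u (posP u) = 0 ∧ energyDeriv s Ω f lam u (negP u) = 0 ∧
    ¬ (posP u =ᵐ[volume] 0) ∧ ¬ (negP u =ᵐ[volume] 0)}

/-- `γ_λ = inf {I_λ(u) : u ∈ M_λ}`. -/
def nodalLevel {N : ℕ} (s : ℝ) (Ω : Set (EuclideanSpace ℝ (Fin N)))
    (f : EuclideanSpace ℝ (Fin N) → ℝ → ℝ) (lam : ℝ) : ℝ :=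
  sInf (energy s Ω f lam '' nodalNehari s Ω f lam)

end

/-! Write p for the critical exponent. On the nodal Nehari set ⟨I'(u), u⟩ = ⟨I'(u), u⁺⟩ + ⟨I'(u),
u⁻⟩ = 0, so I(u) = I(u) - ½⟨I'(u), u⟩ = (1/2 - 1/p)∫|u|^p + λ∫(½ f(x,u)u - F(x,u)) ≥ 0, because p >
2 and μ > 2 (`energy_nonneg_of_mem_nodalNehari`). Splitting the integrals requires |u|^p to be
integrable, which is the fractional Sobolev embedding `integrable_rpow_critExp`.

For the upper bound, fix once and for all two disjointly supported bumps ψ ≥ 0 ≥ χ in Ω and look for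
aψ + bχ in the set. With A = ‖ψ‖², B = ‖χ‖², D = ⟨χ, ψ⟩ > 0, P = ∫|ψ|^p and Q = ∫|χ|^p, the two
Nehari conditions become a²A + abD = a^p P + λ∫f(x,aψ)aψ and b²B + abD = b^p Q + λ∫f(x,bχ)bχ.
Divided by a and b they read G₁(a) = Db, G₂(b) = Da, and `exists_pos_coupled` solves this system by
the intermediate value theorem.

As λ → ∞ the solutions tend to 0. The critical terms confine (a, b) to a box independent of λ, so
both λ-terms are at most some M independent of λ (`exists_bound_of_coupled`). Since ∫f(x,aψ)aψ is
nondecreasing in a > 0 and positive, a > ε would violate this bound for large λ; likewise for b.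
Hence 0 ≤ γ_λ ≤ ½‖aψ + bχ‖² ≤ ½(A + 2D + B)ε² for large λ (`tendsto_nodalLevel`). -/

/-! ### The critical exponent and the Gagliardo form. -/

theorem two_lt_critExp_and_sub_two_eq {N : ℕ} {s : ℝ} (hs0 : 0 < s) (hsN : 2 * s < (N : ℝ)) :
    2 < critExp N s ∧ critExp N s - 2 = critExp N s * (2 * s / N) := by
  have hN : (0 : ℝ) < N := by linarith
  have hd : (0 : ℝ) < N - 2 * s := by linarith
  unfold critExp
  constructor
  · rw [lt_div_iff₀ hd]; linarith
  · field_simp; ring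

theorem two_lt_critExp {N : ℕ} {s : ℝ} (hs0 : 0 < s) (hsN : 2 * s < (N : ℝ)) :
    2 < critExp N s := (two_lt_critExp_and_sub_two_eq hs0 hsN).1

theorem gagliardoIntegrand_self_nonneg {N : ℕ} (s : ℝ) (u : EuclideanSpace ℝ (Fin N) → ℝ)
    (z : EuclideanSpace ℝ (Fin N) × EuclideanSpace ℝ (Fin N)) :
    0 ≤ gagliardoIntegrand s u u z :=
  div_nonneg (mul_self_nonneg _) (Real.rpow_nonneg (norm_nonneg _) _)

theorem gagliardoInner_self_nonneg {N : ℕ} (s : ℝ) (u : EuclideanSpace ℝ (Fin N) → ℝ) :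
    0 ≤ gagliardoInner s u u :=
  integral_nonneg (gagliardoIntegrand_self_nonneg s u)

theorem aestronglyMeasurable_gagliardoIntegrand {N : ℕ} (s : ℝ)
    {u v : EuclideanSpace ℝ (Fin N) → ℝ} (hu : AEStronglyMeasurable u volume)
    (hv : AEStronglyMeasurable v volume) :
    AEStronglyMeasurable (gagliardoIntegrand s u v) volume := by
  have h1 : ∀ {w : EuclideanSpace ℝ (Fin N) → ℝ}, AEStronglyMeasurable w volume →
      AEMeasurable (fun z : EuclideanSpace ℝ (Fin N) × EuclideanSpace ℝ (Fin N) => w z.1 - w z.2)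
        volume := fun hw =>
    ((hw.comp_fst (ν := volume)).sub (hw.comp_snd (μ := volume))).aemeasurable
  have h2 : Measurable (fun z : EuclideanSpace ℝ (Fin N) × EuclideanSpace ℝ (Fin N) =>
      ‖z.1 - z.2‖ ^ ((N : ℝ) + 2 * s)) := by fun_prop
  exact (((h1 hu).mul (h1 hv)).div h2.aemeasurable).aestronglyMeasurable

theorem gagliardoIntegrand_congr_ae {N : ℕ} (s : ℝ) {u u' v v' : EuclideanSpace ℝ (Fin N) → ℝ}
    (hu : u =ᵐ[volume] u') (hv : v =ᵐ[volume] v') :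
    gagliardoIntegrand s u v =ᵐ[volume] gagliardoIntegrand s u' v' := by
  have hfst : ∀ {w w' : EuclideanSpace ℝ (Fin N) → ℝ}, w =ᵐ[volume] w' →
      ∀ᵐ z : EuclideanSpace ℝ (Fin N) × EuclideanSpace ℝ (Fin N), w z.1 = w' z.1 := fun h =>
    Measure.quasiMeasurePreserving_fst.ae h
  have hsnd : ∀ {w w' : EuclideanSpace ℝ (Fin N) → ℝ}, w =ᵐ[volume] w' →
      ∀ᵐ z : EuclideanSpace ℝ (Fin N) × EuclideanSpace ℝ (Fin N), w z.2 = w' z.2 := fun h =>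
    Measure.quasiMeasurePreserving_snd.ae h
  filter_upwards [hfst hu, hsnd hu, hfst hv, hsnd hv] with z h1 h2 h3 h4
  simp only [gagliardoIntegrand, h1, h2, h3, h4]

/-- A pair of increments dominated by those of `w` gives an integrable Gagliardo integrand. -/
theorem integrable_gagliardoIntegrand_of_le {N : ℕ} {s : ℝ}
    {u v w : EuclideanSpace ℝ (Fin N) → ℝ} (hu : AEStronglyMeasurable u volume)
    (hv : AEStronglyMeasurable v volume)
    (hw : Integrable (gagliardoIntegrand s w w) volume)
    (h1 : ∀ x y, |u x - u y| ≤ |w x - w y|) (h2 : ∀ x y, |v x - v y| ≤ |w x - w y|) :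
    Integrable (gagliardoIntegrand s u v) volume := by
  refine hw.mono (aestronglyMeasurable_gagliardoIntegrand s hu hv) (Eventually.of_forall fun z => ?_)
  simp only [gagliardoIntegrand, norm_div, norm_mul, Real.norm_eq_abs]
  exact div_le_div_of_nonneg_right (mul_le_mul (h1 _ _) (h2 _ _) (abs_nonneg _) (abs_nonneg _))
    (abs_nonneg _)

theorem integrable_gagliardoIntegrand {N : ℕ} {s : ℝ} {u v : EuclideanSpace ℝ (Fin N) → ℝ}
    (hu : u ∈ fracSobolev N s) (hv : v ∈ fracSobolev N s) :
    Integrable (gagliardoIntegrand s u v) volume := by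
  refine (hu.2.add hv.2).mono
    (aestronglyMeasurable_gagliardoIntegrand s hu.1.1 hv.1.1) (Eventually.of_forall fun z => ?_)
  have h0 : 0 ≤ ‖z.1 - z.2‖ ^ ((N : ℝ) + 2 * s) := by positivity
  simp only [Pi.add_apply, gagliardoIntegrand]
  rw [← add_div, norm_div, norm_div]
  refine div_le_div_of_nonneg_right ?_ (norm_nonneg _)
  rw [Real.norm_eq_abs, Real.norm_eq_abs]
  rw [abs_le]
  have h3 := le_abs_self ((u z.1 - u z.2) * (u z.1 - u z.2) + (v z.1 - v z.2) * (v z.1 - v z.2))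
  constructor <;>
    nlinarith [sq_nonneg ((u z.1 - u z.2) + (v z.1 - v z.2)),
      sq_nonneg ((u z.1 - u z.2) - (v z.1 - v z.2)),
      mul_self_nonneg (u z.1 - u z.2), mul_self_nonneg (v z.1 - v z.2)]

theorem gagliardoInner_self_mono {N : ℕ} {s : ℝ} {u w : EuclideanSpace ℝ (Fin N) → ℝ}
    (hw : Integrable (gagliardoIntegrand s w w) volume)
    (h1 : ∀ x y, |u x - u y| ≤ |w x - w y|) :
    gagliardoInner s u u ≤ gagliardoInner s w w := by
  refine integral_mono_of_nonneg (Eventually.of_forall (gagliardoIntegrand_self_nonneg s u)) hw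
    (Eventually.of_forall fun z => ?_)
  simp only [gagliardoIntegrand, ← abs_mul_abs_self (u z.1 - u z.2),
    ← abs_mul_abs_self (w z.1 - w z.2)]
  exact div_le_div_of_nonneg_right (mul_le_mul (h1 _ _) (h1 _ _) (abs_nonneg _) (abs_nonneg _))
    (Real.rpow_nonneg (norm_nonneg _) _)

/-! ### The fractional Sobolev embedding. -/

/-- The pointwise estimate behind the fractional Sobolev inequality. -/
theorem rpow_critExp_le_lintegral_gagliardoIntegrand {N : ℕ} {s : ℝ} (hs0 : 0 < s)
    (hsN : 2 * s < (N : ℝ)) :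
    ∃ K : ℝ, 0 < K ∧ ∀ (u : EuclideanSpace ℝ (Fin N) → ℝ) (W : ℝ), Measurable u → 0 < W →
      ∫⁻ y, ENNReal.ofReal (|u y| ^ critExp N s) ≤ ENNReal.ofReal W →
      ∀ x, ENNReal.ofReal (K * |u x| ^ critExp N s * W ^ (-(2 * s / N))) ≤
        ∫⁻ y, ENNReal.ofReal (gagliardoIntegrand s u u (x, y)) := by
  have hN : (0 : ℝ) < N := by linarith
  have hN' : 0 < N := by exact_mod_cast hN
  have : Nonempty (Fin N) := ⟨⟨0, hN'⟩⟩
  obtain ⟨hp2, hpe⟩ := two_lt_critExp_and_sub_two_eq hs0 hsN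
  set p := critExp N s with hp
  set κ : ℝ := (volume (Metric.ball (0 : EuclideanSpace ℝ (Fin N)) 1)).toReal with hκ
  have hκpos : 0 < κ := ENNReal.toReal_pos (Metric.measure_ball_pos volume _ one_pos).ne'
    measure_ball_lt_top.ne
  set K : ℝ := (2 * 2 ^ p / κ) ^ (-(2 * s / N)) * κ / 8 with hK
  refine ⟨K, by positivity, fun u W hu hW hle x => ?_⟩
  rcases eq_or_ne (u x) 0 with hx0 | hx0
  · rw [hx0, abs_zero, Real.zero_rpow (by linarith)]; simp
  have hm : 0 < |u x| := abs_pos.mpr hx0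
  set m := |u x| with hmdef
  -- By Chebyshev, |u| ≥ m/2 only on a set of measure at most V. The radius r gives the ball around
  -- x measure 2V, so on a part of measure at least V the increment |u(x) - u(y)| is at least m/2.
  set V : ℝ := (2 / m) ^ p * W with hV
  have hVpos : 0 < V := by positivity
  set r : ℝ := (2 * V / κ) ^ (1 / (N : ℝ)) with hr
  have hrpos : 0 < r := by positivity
  have hrN : r ^ N = 2 * V / κ := by
    rw [hr, ← Real.rpow_natCast, ← Real.rpow_mul (by positivity), one_div,
      inv_mul_cancel₀ hN.ne', Real.rpow_one]
  have hball : volume (Metric.ball x r) = ENNReal.ofReal (2 * V) := by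
    rw [Measure.addHaar_ball volume x hrpos.le, finrank_euclideanSpace, Fintype.card_fin, hrN,
      ← ENNReal.ofReal_toReal (measure_ball_lt_top (μ := volume)
        (x := (0 : EuclideanSpace ℝ (Fin N))) (r := 1)).ne, ← ENNReal.ofReal_mul (by positivity)]
    congr 1
    rw [← hκ]
    field_simp
  set S : Set (EuclideanSpace ℝ (Fin N)) := {y | m / 2 ≤ |u y|} with hS
  have hSmeas : MeasurableSet S := measurableSet_le measurable_const (by fun_prop)
  have hSvol : volume S ≤ ENNReal.ofReal V := by
    have h1 := mul_meas_ge_le_lintegral₀ (μ := volume)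
      (f := fun y => ENNReal.ofReal (|u y| ^ p)) (by fun_prop) (ENNReal.ofReal ((m / 2) ^ p))
    have h2 : S ⊆ {y | ENNReal.ofReal ((m / 2) ^ p) ≤ ENNReal.ofReal (|u y| ^ p)} := fun y hy =>
      ENNReal.ofReal_le_ofReal (Real.rpow_le_rpow (by positivity) hy (by linarith))
    have h3 : ENNReal.ofReal ((m / 2) ^ p) * volume S ≤ ENNReal.ofReal W :=
      (mul_le_mul_right (measure_mono h2) _).trans (h1.trans hle)
    have h4 : V = W / (m / 2) ^ p := by
      rw [hV, ← inv_div m 2, Real.inv_rpow (by positivity)]; field_simp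
    rw [h4, ENNReal.ofReal_div_of_pos (by positivity), ENNReal.le_div_iff_mul_le
      (Or.inl (by positivity)) (Or.inl ENNReal.ofReal_ne_top), mul_comm]
    exact h3
  have hdiff : ENNReal.ofReal V ≤ volume (Metric.ball x r \ S) := by
    refine le_trans ?_ le_measure_sdiff
    rw [hball]
    refine le_trans ?_ (tsub_le_tsub_left hSvol _)
    rw [← ENNReal.ofReal_sub _ hVpos.le]
    exact ENNReal.ofReal_le_ofReal (by linarith)
  have hlow : ∀ y ∈ Metric.ball x r \ S, ENNReal.ofReal ((m / 2) ^ 2 / r ^ ((N : ℝ) + 2 * s)) ≤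
      ENNReal.ofReal (gagliardoIntegrand s u u (x, y)) := by
    rintro y ⟨hy, hyS⟩
    apply ENNReal.ofReal_le_ofReal
    have hyS' : |u y| < m / 2 := not_le.mp hyS
    have hxy : x ≠ y := by rintro rfl; linarith
    have hd : m / 2 ≤ |u x - u y| := by
      have := abs_sub_abs_le_abs_sub (u x) (u y); linarith
    have hn : 0 < ‖x - y‖ := norm_pos_iff.mpr (sub_ne_zero.mpr hxy)
    have hnr : ‖x - y‖ ≤ r := by
      rw [Metric.mem_ball, dist_comm, dist_eq_norm] at hy; exact hy.le
    unfold gagliardoIntegrand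
    simp only
    rw [← abs_mul_abs_self, ← sq]
    gcongr
  -- The exponents match because p - 2 = p · 2s/N, and `K` is the constant that makes this an
  -- equality.
  have key : K * m ^ p * W ^ (-(2 * s / N)) = (m / 2) ^ 2 / r ^ ((N : ℝ) + 2 * s) * V := by
    have e1 : r ^ ((N : ℝ) + 2 * s) = r ^ N * (2 * V / κ) ^ (2 * s / N) := by
      rw [Real.rpow_add hrpos, Real.rpow_natCast, hr, ← Real.rpow_mul (by positivity)]
      congr 2; field_simp
    have e2 : (2 * V / κ) = (2 * 2 ^ p / κ) * W * (m ^ p)⁻¹ := by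
      rw [hV, Real.div_rpow (by norm_num) hm.le]; field_simp
    have e3 : (m ^ p)⁻¹ ^ (2 * s / N) = (m ^ (p - 2))⁻¹ := by
      rw [Real.inv_rpow (by positivity), ← Real.rpow_mul hm.le, hpe]
    have e4 : m ^ p = m ^ (p - 2) * m ^ 2 := by
      rw [← Real.rpow_natCast m 2, ← Real.rpow_add hm]; norm_num
    have e5 : (2 * V / κ) ^ (2 * s / N) =
        (2 * 2 ^ p / κ) ^ (2 * s / N) * W ^ (2 * s / N) * (m ^ (p - 2))⁻¹ := by
      rw [e2, Real.mul_rpow (by positivity) (by positivity),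
        Real.mul_rpow (by positivity) (by positivity), e3]
    rw [e1, hrN, e5, hK, Real.rpow_neg (by positivity), Real.rpow_neg hW.le, e4]
    have : 0 < m ^ (p - 2) := by positivity
    have : 0 < W ^ (2 * s / N) := by positivity
    have : 0 < (2 * 2 ^ p / κ) ^ (2 * s / N) := by positivity
    field_simp
    ring
  rw [key]
  calc ENNReal.ofReal ((m / 2) ^ 2 / r ^ ((N : ℝ) + 2 * s) * V)
      = ENNReal.ofReal ((m / 2) ^ 2 / r ^ ((N : ℝ) + 2 * s)) * ENNReal.ofReal V :=
        ENNReal.ofReal_mul (by positivity)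
    _ ≤ ENNReal.ofReal ((m / 2) ^ 2 / r ^ ((N : ℝ) + 2 * s)) * volume (Metric.ball x r \ S) := by
        gcongr
    _ = ∫⁻ _ in Metric.ball x r \ S, ENNReal.ofReal ((m / 2) ^ 2 / r ^ ((N : ℝ) + 2 * s)) :=
        (setLIntegral_const _ _).symm
    _ ≤ ∫⁻ y in Metric.ball x r \ S, ENNReal.ofReal (gagliardoIntegrand s u u (x, y)) :=
        setLIntegral_mono' (measurableSet_ball.diff hSmeas) hlow
    _ ≤ _ := setLIntegral_le_lintegral _ _

/-- The fractional Sobolev inequality for functions already known to be in `L^p`. -/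
theorem integral_rpow_critExp_le {N : ℕ} {s : ℝ} (hs0 : 0 < s) (hsN : 2 * s < (N : ℝ)) :
    ∃ K : ℝ, 0 < K ∧ ∀ (u : EuclideanSpace ℝ (Fin N) → ℝ), Measurable u →
      Integrable (gagliardoIntegrand s u u) volume →
      Integrable (fun y => |u y| ^ critExp N s) volume →
      ∫ y, |u y| ^ critExp N s ≤ (gagliardoInner s u u / K) ^ (1 - 2 * s / N)⁻¹ := by
  obtain ⟨K, hK, H⟩ := rpow_critExp_le_lintegral_gagliardoIntegrand hs0 hsN
  have hN : (0 : ℝ) < N := by linarith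
  refine ⟨K, hK, fun u hu hg hp => ?_⟩
  have hG := gagliardoInner_self_nonneg s u
  have hpn : 0 ≤ fun y => |u y| ^ critExp N s := fun y => Real.rpow_nonneg (abs_nonneg _) _
  have he : 0 < 1 - 2 * s / N := by rw [sub_pos, div_lt_one hN]; exact hsN
  set W := ∫ y, |u y| ^ critExp N s with hW
  -- Integrating the pointwise bound over x gives K W · W^(-2s/N) ≤ ‖u‖². Extracting a bound on W
  -- from this needs W finite, which is why integrability is assumed, and W > 0.
  rcases (integral_nonneg hpn : 0 ≤ W).eq_or_lt with h0 | hpos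
  · have hr : 0 ≤ (gagliardoInner s u u / K) ^ (1 - 2 * s / N)⁻¹ := by positivity
    exact h0.symm.trans_le hr
  have hWl : ∫⁻ y, ENNReal.ofReal (|u y| ^ critExp N s) = ENNReal.ofReal W :=
    (ofReal_integral_eq_lintegral_ofReal hp (Eventually.of_forall hpn)).symm
  have h1 := lintegral_mono (μ := volume) (H u W hu hpos hWl.le)
  have h2 : ∫⁻ x, ENNReal.ofReal (K * |u x| ^ critExp N s * W ^ (-(2 * s / N))) =
      ENNReal.ofReal (K * W ^ (1 - 2 * s / N)) := by
    rw [← ofReal_integral_eq_lintegral_ofReal ((hp.const_mul K).mul_const _)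
      (Eventually.of_forall fun y => by have := hpn y; simp only [Pi.zero_apply] at this ⊢; positivity),
      integral_mul_const, integral_const_mul, ← hW, sub_eq_add_neg, Real.rpow_add hpos,
      Real.rpow_one, mul_assoc]
  have h3 : ∫⁻ x, ∫⁻ y, ENNReal.ofReal (gagliardoIntegrand s u u (x, y)) =
      ENNReal.ofReal (gagliardoInner s u u) := by
    rw [gagliardoInner, ofReal_integral_eq_lintegral_ofReal hg
      (Eventually.of_forall (gagliardoIntegrand_self_nonneg s u))]
    exact (lintegral_prod _ hg.1.aemeasurable.ennreal_ofReal).symm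
  rw [h2, h3, ENNReal.ofReal_le_ofReal_iff hG] at h1
  rw [Real.le_rpow_inv_iff_of_pos hpos.le (by positivity) he, le_div_iff₀ hK, mul_comm]
  exact h1

/-- The fractional Sobolev embedding `Hˢ(ℝ^N) ⊆ L^p(ℝ^N)` for the critical exponent `p`. -/
theorem integrable_rpow_critExp {N : ℕ} {s : ℝ} (hs0 : 0 < s) (hsN : 2 * s < (N : ℝ))
    {u : EuclideanSpace ℝ (Fin N) → ℝ} (hu : u ∈ fracSobolev N s) :
    Integrable (fun y => |u y| ^ critExp N s) volume := by
  wlog hmeas : Measurable u generalizing u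
  · have hae := hu.1.1.ae_eq_mk
    have hmk : hu.1.1.mk u ∈ fracSobolev N s :=
      ⟨hu.1.ae_eq hae, hu.2.congr (gagliardoIntegrand_congr_ae s hae hae)⟩
    refine (this hmk hu.1.1.stronglyMeasurable_mk.measurable).congr ?_
    filter_upwards [hae] with x hx
    rw [hx]
  obtain ⟨hp2, -⟩ := two_lt_critExp_and_sub_two_eq hs0 hsN
  obtain ⟨K, hK, H⟩ := integral_rpow_critExp_le hs0 hsN
  set p := critExp N s with hp
  have he : 0 ≤ (1 - 2 * s / N)⁻¹ := by
    have hN : (0 : ℝ) < N := by linarith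
    exact (inv_pos.mpr (by rw [sub_pos, div_lt_one hN]; exact hsN)).le
  -- The truncations are bounded and square integrable, hence in L^p. They do not increase
  -- increments, so the Sobolev bound holds for all of them with the constant of u, and monotone
  -- convergence passes it to u.
  let T : ℕ → EuclideanSpace ℝ (Fin N) → ℝ := fun n x => max (min (u x) n) (-n)
  have hTmeas : ∀ n, Measurable (T n) := fun n => by fun_prop
  have hTabs : ∀ n x, |T n x| = min |u x| n := by
    intro n x
    have hn : (0 : ℝ) ≤ n := n.cast_nonneg
    simp only [T]
    rcases le_total 0 (u x) with h | h
    · rw [abs_of_nonneg h, max_eq_left (by have := le_min h hn; linarith),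
        abs_of_nonneg (le_min h hn)]
    · rw [abs_of_nonpos h, min_eq_left (by linarith), abs_of_nonpos (max_le h (by linarith)),
        ← min_neg_neg, neg_neg]
  have hTdiff : ∀ n x y, |T n x - T n y| ≤ |u x - u y| := fun n x y =>
    (abs_max_sub_max_le_abs _ _ _).trans ((abs_min_sub_min_le_max _ _ _ _).trans (by simp))
  have hTint : ∀ n, Integrable (fun y => |T n y| ^ p) volume := by
    intro n
    refine (hu.1.integrable_sq.const_mul ((n : ℝ) ^ (p - 2))).mono'
      ((hTmeas n).abs.pow_const p).aestronglyMeasurable (Eventually.of_forall fun x => ?_)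
    rw [Real.norm_of_nonneg (by positivity)]
    have h1 : |T n x| ≤ n := (hTabs n x).trans_le (min_le_right _ _)
    have h2 : |T n x| ≤ |u x| := (hTabs n x).trans_le (min_le_left _ _)
    rcases (abs_nonneg (T n x)).eq_or_lt with h0 | h0
    · rw [← h0, Real.zero_rpow (by linarith)]; positivity
    · calc |T n x| ^ p = |T n x| ^ (p - 2) * |T n x| ^ 2 := by
            rw [← Real.rpow_natCast _ 2, ← Real.rpow_add h0]; norm_num
        _ ≤ (n : ℝ) ^ (p - 2) * |u x| ^ 2 := by gcongr
        _ = _ := by rw [sq_abs]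
  set M := (gagliardoInner s u u / K) ^ (1 - 2 * s / N)⁻¹
  have hbound : ∀ n, ∫⁻ y, ENNReal.ofReal (|T n y| ^ p) ≤ ENNReal.ofReal M := by
    intro n
    rw [← ofReal_integral_eq_lintegral_ofReal (hTint n)
      (Eventually.of_forall fun y => by simp only [Pi.zero_apply]; positivity)]
    refine ENNReal.ofReal_le_ofReal ((H (T n) (hTmeas n) (integrable_gagliardoIntegrand_of_le
      (hTmeas n).aestronglyMeasurable (hTmeas n).aestronglyMeasurable hu.2 (hTdiff n) (hTdiff n))
      (hTint n)).trans ?_)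
    have := gagliardoInner_self_nonneg s (T n)
    have := gagliardoInner_self_mono hu.2 (hTdiff n)
    exact Real.rpow_le_rpow (by positivity) (by gcongr) he
  have hlim : Tendsto (fun n => ∫⁻ y, ENNReal.ofReal (|T n y| ^ p)) atTop
      (𝓝 (∫⁻ y, ENNReal.ofReal (|u y| ^ p))) := by
    refine lintegral_tendsto_of_tendsto_of_monotone (fun n => by fun_prop)
      (Eventually.of_forall fun x n k hnk => ?_) (Eventually.of_forall fun x => ?_)
    · apply ENNReal.ofReal_le_ofReal
      simp only [hTabs]
      gcongr
    · apply tendsto_const_nhds.congr'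
      obtain ⟨k, hk⟩ := exists_nat_ge |u x|
      filter_upwards [eventually_ge_atTop k] with n hn
      have : (k : ℝ) ≤ n := by exact_mod_cast hn
      rw [hTabs, min_eq_left (hk.trans this)]
  have hfin := le_of_tendsto' hlim hbound
  refine ⟨(hmeas.abs.pow_const p).aestronglyMeasurable, ?_⟩
  rw [hasFiniteIntegral_iff_ofReal (Eventually.of_forall fun y => by
    simp only [Pi.zero_apply]; positivity)]
  exact hfin.trans_lt ENNReal.ofReal_lt_top

/-! ### Positive and negative parts, and the lower bound for the energy. -/

theorem abs_rpow_sub_two_mul_mul_self {p t : ℝ} (hp : 2 < p) :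
    |t| ^ (p - 2) * t * t = |t| ^ p := by
  rcases eq_or_ne t 0 with rfl | ht
  · simp [Real.zero_rpow (by linarith : p ≠ 0)]
  · rw [mul_assoc, ← abs_mul_abs_self, ← sq, ← Real.rpow_natCast, ← Real.rpow_add (abs_pos.mpr ht)]
    norm_num

theorem posP_add_negP {N : ℕ} (u : EuclideanSpace ℝ (Fin N) → ℝ) (x : EuclideanSpace ℝ (Fin N)) :
    posP u x + negP u x = u x := by
  simp [posP, negP, max_add_min]

theorem abs_posP_le {N : ℕ} (u : EuclideanSpace ℝ (Fin N) → ℝ) (x : EuclideanSpace ℝ (Fin N)) :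
    |posP u x| ≤ |u x| := by
  unfold posP; simpa using abs_max_sub_max_le_abs (u x) 0 0

theorem abs_negP_le {N : ℕ} (u : EuclideanSpace ℝ (Fin N) → ℝ) (x : EuclideanSpace ℝ (Fin N)) :
    |negP u x| ≤ |u x| := by
  unfold negP; simpa using abs_min_sub_min_le_max (u x) 0 0 0

theorem aestronglyMeasurable_posP {N : ℕ} {u : EuclideanSpace ℝ (Fin N) → ℝ}
    {m : Measure (EuclideanSpace ℝ (Fin N))} (hu : AEStronglyMeasurable u m) :
    AEStronglyMeasurable (posP u) m := hu.sup aestronglyMeasurable_const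

theorem aestronglyMeasurable_negP {N : ℕ} {u : EuclideanSpace ℝ (Fin N) → ℝ}
    {m : Measure (EuclideanSpace ℝ (Fin N))} (hu : AEStronglyMeasurable u m) :
    AEStronglyMeasurable (negP u) m := hu.inf aestronglyMeasurable_const

theorem integral_mul_posP_add_integral_mul_negP {N : ℕ} {u g : EuclideanSpace ℝ (Fin N) → ℝ}
    {m : Measure (EuclideanSpace ℝ (Fin N))} (hu : AEStronglyMeasurable u m)
    (hg : AEStronglyMeasurable g m) (hi : Integrable (fun x => g x * u x) m) :
    ∫ x, g x * posP u x ∂m + ∫ x, g x * negP u x ∂m = ∫ x, g x * u x ∂m := by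
  have h1 : Integrable (fun x => g x * posP u x) m :=
    hi.mono (hg.mul (aestronglyMeasurable_posP hu)) (Eventually.of_forall fun x => by
      rw [norm_mul, norm_mul]; exact mul_le_mul_of_nonneg_left (abs_posP_le u x) (norm_nonneg _))
  have h2 : Integrable (fun x => g x * negP u x) m :=
    hi.mono (hg.mul (aestronglyMeasurable_negP hu)) (Eventually.of_forall fun x => by
      rw [norm_mul, norm_mul]; exact mul_le_mul_of_nonneg_left (abs_negP_le u x) (norm_nonneg _))
  rw [← integral_add h1 h2]
  simp only [← mul_add, posP_add_negP]

theorem gagliardoInner_posP_add_negP {N : ℕ} {s : ℝ} {u : EuclideanSpace ℝ (Fin N) → ℝ}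
    (hu : u ∈ fracSobolev N s) :
    gagliardoInner s u (posP u) + gagliardoInner s u (negP u) = gagliardoInner s u u := by
  have h1 := integrable_gagliardoIntegrand_of_le hu.1.1 (aestronglyMeasurable_posP hu.1.1) hu.2
    (fun _ _ => le_rfl) (fun x y => abs_max_sub_max_le_abs (u x) (u y) 0)
  have h2 := integrable_gagliardoIntegrand_of_le hu.1.1 (aestronglyMeasurable_negP hu.1.1) hu.2
    (fun _ _ => le_rfl) (fun x y => (abs_min_sub_min_le_max (u x) 0 (u y) 0).trans (by simp))
  rw [gagliardoInner, gagliardoInner, ← integral_add h1 h2]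
  refine integral_congr_ae (Eventually.of_forall fun z => ?_)
  simp only [gagliardoIntegrand]
  rw [← add_div, ← posP_add_negP u z.1, ← posP_add_negP u z.2]
  ring_nf

/-- The energy is nonnegative on the nodal Nehari set. -/
theorem energy_nonneg_of_mem_nodalNehari {N : ℕ} {s : ℝ} (hs0 : 0 < s) (hsN : 2 * s < (N : ℝ))
    {Ω : Set (EuclideanSpace ℝ (Fin N))} (hb : Bornology.IsBounded Ω)
    {f : EuclideanSpace ℝ (Fin N) → ℝ → ℝ} (hf : Continuous (Function.uncurry f)) {C : ℝ}
    (hgrow : ∀ᵐ x ∂(volume.restrict Ω), ∀ t, |f x t * t| ≤ C * (1 + |t| ^ critExp N s))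
    (hF : ∀ᵐ x ∂(volume.restrict Ω), ∀ t, 0 ≤ primitiveF f x t ∧
      2 * primitiveF f x t ≤ t * f x t)
    {lam : ℝ} (hlam : 0 ≤ lam) {u : EuclideanSpace ℝ (Fin N) → ℝ}
    (hu : u ∈ nodalNehari s Ω f lam) : 0 ≤ energy s Ω f lam u := by
  obtain ⟨⟨hus, -⟩, hpos, hneg, -, -⟩ := hu
  have hp2 := two_lt_critExp hs0 hsN
  have hSob := (integrable_rpow_critExp hs0 hsN hus).restrict (s := Ω)
  have hum : AEStronglyMeasurable u (volume.restrict Ω) := hus.1.1.restrict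
  have hfm : AEStronglyMeasurable (fun x => f x (u x)) (volume.restrict Ω) :=
    hf.comp_aestronglyMeasurable (aestronglyMeasurable_id.prodMk hum)
  have : IsFiniteMeasure (volume.restrict Ω) := ⟨by
    rw [Measure.restrict_apply_univ]; exact hb.measure_lt_top⟩
  have hfu : Integrable (fun x => f x (u x) * u x) (volume.restrict Ω) := by
    refine (((integrable_const (1 : ℝ)).add hSob).const_mul C).mono' (hfm.mul hum) ?_
    filter_upwards [hgrow] with x hx
    exact hx (u x)
  have e1 := gagliardoInner_posP_add_negP hus
  have hgm : AEStronglyMeasurable (fun x => |u x| ^ (critExp N s - 2) * u x)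
      (volume.restrict Ω) :=
    ((hum.aemeasurable.abs.pow_const _).mul hum.aemeasurable).aestronglyMeasurable
  have e2 := integral_mul_posP_add_integral_mul_negP hum hgm
    (by simpa only [abs_rpow_sub_two_mul_mul_self hp2] using hSob)
  simp only [abs_rpow_sub_two_mul_mul_self hp2] at e2
  have e3 := integral_mul_posP_add_integral_mul_negP hum hfm hfu
  unfold energyDeriv at hpos hneg
  -- Only the dominating function has to be integrable here, so neither measurability nor
  -- integrability of F(x,u) is needed.
  have hFle : ∫ x in Ω, primitiveF f x (u x) ≤ ∫ x in Ω, 1 / 2 * (f x (u x) * u x) := by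
    refine integral_mono_of_nonneg ?_ (hfu.const_mul _) ?_
    · filter_upwards [hF] with x hx using (hx _).1
    · filter_upwards [hF] with x hx
      have := (hx (u x)).2
      linarith
  rw [integral_const_mul] at hFle
  have hP : 0 ≤ ∫ x in Ω, |u x| ^ critExp N s :=
    integral_nonneg fun x => Real.rpow_nonneg (abs_nonneg _) _
  have h5 : 1 / critExp N s ≤ 1 / 2 := one_div_le_one_div_of_le two_pos hp2.le
  have h6 := mul_le_mul_of_nonneg_right h5 hP
  have h7 := mul_le_mul_of_nonneg_left hFle hlam
  unfold energy
  rw [← e1, ← e2] at *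
  rw [← e3] at h7
  linarith

/-! ### Tent functions have finite Gagliardo energy. -/

/-- In polar coordinates the integrand is at most r^(1-2s) on (0,1], integrable since s < 1, and at
most ρ² r^(-1-2s) beyond, integrable since s > 0. -/
theorem integrable_min_sq_div_rpow {N : ℕ} {s ρ : ℝ} (hs0 : 0 < s) (hs1 : s < 1) (hN : 0 < N) :
    Integrable (fun z : EuclideanSpace ℝ (Fin N) =>
      min (‖z‖ ^ 2) (ρ ^ 2) / ‖z‖ ^ ((N : ℝ) + 2 * s)) volume := by
  have : Nonempty (Fin N) := ⟨⟨0, hN⟩⟩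
  rw [integrable_fun_norm_addHaar volume
    (f := fun r : ℝ => min (r ^ 2) (ρ ^ 2) / r ^ ((N : ℝ) + 2 * s)), finrank_euclideanSpace,
    Fintype.card_fin, ← Ioc_union_Ioi_eq_Ioi zero_le_one]
  have hm : Measurable fun r : ℝ => r ^ (N - 1) • (min (r ^ 2) (ρ ^ 2) / r ^ ((N : ℝ) + 2 * s)) := by
    have : Measurable fun r : ℝ => r ^ ((N : ℝ) + 2 * s) := measurable_id.pow_const _
    fun_prop
  have hpow : ∀ r : ℝ, 0 < r → r ^ (N - 1) = r ^ ((N : ℝ) - 1) := fun r hr => by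
    rw [← Real.rpow_natCast, Nat.cast_sub hN, Nat.cast_one]
  refine IntegrableOn.union ?_ ?_
  · have h1 : IntegrableOn (fun r : ℝ => r ^ (1 - 2 * s)) (Ioc 0 1) :=
      (intervalIntegrable_iff_integrableOn_Ioc_of_le zero_le_one).mp
        (intervalIntegral.intervalIntegrable_rpow' (by linarith))
    refine h1.mono' hm.aestronglyMeasurable ?_
    filter_upwards [ae_restrict_mem measurableSet_Ioc] with r hr
    have hr0 : 0 < r := hr.1
    rw [smul_eq_mul, Real.norm_of_nonneg (by positivity)]
    calc r ^ (N - 1) * (min (r ^ 2) (ρ ^ 2) / r ^ ((N : ℝ) + 2 * s))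
        ≤ r ^ ((N : ℝ) - 1) * (r ^ 2 / r ^ ((N : ℝ) + 2 * s)) := by
          rw [hpow r hr0]; gcongr; exact min_le_left _ _
      _ = r ^ (1 - 2 * s) := by
          rw [← Real.rpow_natCast r 2, ← Real.rpow_sub hr0, ← Real.rpow_add hr0]
          congr 1; push_cast; ring
  · have h1 : IntegrableOn (fun r : ℝ => ρ ^ 2 * r ^ (-1 - 2 * s)) (Ioi 1) :=
      (integrableOn_Ioi_rpow_of_lt (by linarith) one_pos).const_mul _
    refine h1.mono' hm.aestronglyMeasurable ?_
    filter_upwards [ae_restrict_mem measurableSet_Ioi] with r hr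
    have hr0 : 0 < r := one_pos.trans hr
    rw [smul_eq_mul, Real.norm_of_nonneg (by positivity)]
    calc r ^ (N - 1) * (min (r ^ 2) (ρ ^ 2) / r ^ ((N : ℝ) + 2 * s))
        ≤ r ^ ((N : ℝ) - 1) * (ρ ^ 2 / r ^ ((N : ℝ) + 2 * s)) := by
          rw [hpow r hr0]; gcongr; exact min_le_right _ _
      _ = ρ ^ 2 * r ^ (-1 - 2 * s) := by
          rw [mul_div_left_comm, ← Real.rpow_sub hr0]
          congr 2; ring

/-- The tent function of height and radius `ρ` centred at `c`. -/
noncomputable def tent {N : ℕ} (c : EuclideanSpace ℝ (Fin N)) (ρ : ℝ) (x : EuclideanSpace ℝ (Fin N)) : ℝ :=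
  max (ρ - dist x c) 0

theorem tent_nonneg {N : ℕ} (c : EuclideanSpace ℝ (Fin N)) (ρ : ℝ) (x) : 0 ≤ tent c ρ x :=
  le_max_right _ _

theorem tent_pos_iff {N : ℕ} {c : EuclideanSpace ℝ (Fin N)} {ρ : ℝ} {x} :
    0 < tent c ρ x ↔ x ∈ Metric.ball c ρ := by
  simp [tent, Metric.mem_ball]

theorem tent_eq_zero {N : ℕ} {c : EuclideanSpace ℝ (Fin N)} {ρ : ℝ} {x}
    (hx : x ∉ Metric.ball c ρ) : tent c ρ x = 0 :=
  ((tent_nonneg c ρ x).eq_or_lt.resolve_right fun h => hx (tent_pos_iff.mp h)).symm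

theorem continuous_tent {N : ℕ} (c : EuclideanSpace ℝ (Fin N)) (ρ : ℝ) :
    Continuous (tent c ρ) := by
  unfold tent; fun_prop

/-- The tent is 1-Lipschitz with values in [0, ρ] and vanishes off the ball. With 1_B the indicator
of the ball and k the kernel of `integrable_min_sq_div_rpow`, its Gagliardo integrand is therefore
at most (1_B(x) + 1_B(y)) k(x - y), a sum of two convolution integrands of integrable functions. -/
theorem tent_mem_fracSobolev {N : ℕ} {s : ℝ} (hs0 : 0 < s) (hs1 : s < 1) (hN : 0 < N)
    (c : EuclideanSpace ℝ (Fin N)) {ρ : ℝ} (hρ : 0 ≤ ρ) : tent c ρ ∈ fracSobolev N s := by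
  have hcont := continuous_tent c ρ
  refine ⟨hcont.memLp_of_hasCompactSupport (HasCompactSupport.intro (isCompact_closedBall c ρ)
    fun x hx => tent_eq_zero fun h => hx (Metric.ball_subset_closedBall h)), ?_⟩
  set k : EuclideanSpace ℝ (Fin N) → ℝ := fun z =>
    min (‖z‖ ^ 2) (ρ ^ 2) / ‖z‖ ^ ((N : ℝ) + 2 * s) with hk
  have hki : Integrable k volume := integrable_min_sq_div_rpow hs0 hs1 hN
  have hk0 : ∀ z, 0 ≤ k z := fun z => by positivity
  have hksymm : ∀ x y, k (x - y) = k (y - x) := fun x y => by simp only [hk, norm_sub_rev]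
  set χ : EuclideanSpace ℝ (Fin N) → ℝ := (Metric.ball c ρ).indicator 1 with hχ
  have hχ0 : ∀ x, 0 ≤ χ x := fun x => indicator_nonneg (fun _ _ => zero_le_one) x
  have hχi : Integrable χ volume :=
    (integrable_indicator_iff measurableSet_ball).mpr
      (integrableOn_const measure_ball_lt_top.ne)
  have h1 : Integrable (fun z : EuclideanSpace ℝ (Fin N) × EuclideanSpace ℝ (Fin N) =>
      χ z.2 * k (z.1 - z.2)) (volume.prod volume) := by
    simpa using hχi.convolution_integrand (ContinuousLinearMap.mul ℝ ℝ) hki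
  have h2 : Integrable (fun z : EuclideanSpace ℝ (Fin N) × EuclideanSpace ℝ (Fin N) =>
      χ z.1 * k (z.2 - z.1)) (volume.prod volume) := h1.swap
  refine (h1.add h2).mono' (aestronglyMeasurable_gagliardoIntegrand s
    hcont.aestronglyMeasurable hcont.aestronglyMeasurable) (Eventually.of_forall fun z => ?_)
  rw [Real.norm_of_nonneg (gagliardoIntegrand_self_nonneg _ _ _), Pi.add_apply,
    hksymm z.2 z.1, ← add_mul]
  by_cases hz : z.1 ∈ Metric.ball c ρ ∨ z.2 ∈ Metric.ball c ρ
  · have hone : 1 ≤ χ z.2 + χ z.1 := by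
      rcases hz with h | h
      · have : χ z.1 = 1 := by simp [hχ, h]
        linarith [hχ0 z.2]
      · have : χ z.2 = 1 := by simp [hχ, h]
        linarith [hχ0 z.1]
    refine le_trans ?_ (le_mul_of_one_le_left (hk0 _) hone)
    unfold gagliardoIntegrand
    refine div_le_div_of_nonneg_right (le_min ?_ ?_) (Real.rpow_nonneg (norm_nonneg _) _)
    · rw [← abs_mul_abs_self, ← sq]
      have h3 : |tent c ρ z.1 - tent c ρ z.2| ≤ ‖z.1 - z.2‖ := by
        refine (abs_max_sub_max_le_abs _ _ _).trans ?_
        rw [sub_sub_sub_cancel_left, abs_sub_comm, ← dist_eq_norm]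
        exact abs_dist_sub_le _ _ _
      gcongr
    · rw [← sq]
      have h4 : ∀ x, tent c ρ x ≤ ρ := fun x => max_le (by linarith [dist_nonneg (x := x) (y := c)]) hρ
      have h5 := tent_nonneg c ρ
      exact sq_le_sq' (by linarith [h4 z.2, h5 z.1]) (by linarith [h4 z.1, h5 z.2])
  · push Not at hz
    simp only [gagliardoIntegrand, tent_eq_zero hz.1, tent_eq_zero hz.2]
    simp only [sub_self, zero_mul, zero_div]
    exact mul_nonneg (add_nonneg (hχ0 _) (hχ0 _)) (hk0 _)

/-! ### Reduction to two coupled scalar equations. -/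

/-- Disjoint supports decouple the local terms completely; only the nonlocal form keeps a cross
term. -/
theorem energyDeriv_smul_add_smul {N : ℕ} {s : ℝ} (hs0 : 0 < s) (hsN : 2 * s < (N : ℝ))
    (Ω : Set (EuclideanSpace ℝ (Fin N))) (f : EuclideanSpace ℝ (Fin N) → ℝ → ℝ) (lam : ℝ)
    {ψ χ : EuclideanSpace ℝ (Fin N) → ℝ} (hψ : ψ ∈ fracSobolev N s) (hχ : χ ∈ fracSobolev N s)
    (hdisj : ∀ x, ψ x = 0 ∨ χ x = 0) {a : ℝ} (ha : 0 < a) (b : ℝ) :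
    energyDeriv s Ω f lam (fun x => a * ψ x + b * χ x) (fun x => a * ψ x) =
      a ^ 2 * gagliardoInner s ψ ψ + a * b * gagliardoInner s χ ψ -
        a ^ critExp N s * (∫ x in Ω, |ψ x| ^ critExp N s) -
        lam * ∫ x in Ω, f x (a * ψ x) * (a * ψ x) := by
  have hp2 := two_lt_critExp hs0 hsN
  have e1 : gagliardoInner s (fun x => a * ψ x + b * χ x) (fun x => a * ψ x) =
      a ^ 2 * gagliardoInner s ψ ψ + a * b * gagliardoInner s χ ψ := by
    simp only [gagliardoInner]
    rw [← integral_const_mul, ← integral_const_mul,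
      ← integral_add (hψ.2.const_mul _) ((integrable_gagliardoIntegrand hχ hψ).const_mul _)]
    refine integral_congr_ae (Eventually.of_forall fun z => ?_)
    simp only [gagliardoIntegrand]
    ring
  have e2 : ∫ x in Ω, |a * ψ x + b * χ x| ^ (critExp N s - 2) * (a * ψ x + b * χ x) * (a * ψ x) =
      a ^ critExp N s * ∫ x in Ω, |ψ x| ^ critExp N s := by
    rw [← integral_const_mul]
    refine integral_congr_ae (Eventually.of_forall fun x => ?_)
    simp only
    rcases hdisj x with h | h
    · simp [h, Real.zero_rpow (by linarith : critExp N s ≠ 0)]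
    · rw [h, mul_zero, add_zero, abs_rpow_sub_two_mul_mul_self hp2, abs_mul, abs_of_pos ha,
        Real.mul_rpow ha.le (abs_nonneg _)]
  have e3 : ∫ x in Ω, f x (a * ψ x + b * χ x) * (a * ψ x) =
      ∫ x in Ω, f x (a * ψ x) * (a * ψ x) := by
    refine integral_congr_ae (Eventually.of_forall fun x => ?_)
    simp only
    rcases hdisj x with h | h
    · simp [h]
    · rw [h, mul_zero, add_zero]
  rw [energyDeriv, e1, e2, e3]

/-- Solvability of the coupled system `G₁ a = D b`, `G₂ b = D a` in positive numbers. -/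
theorem exists_pos_coupled {G₁ G₂ : ℝ → ℝ} (h₁ : ContinuousOn G₁ (Ici 0))
    (h₂ : ContinuousOn G₂ (Ici 0)) (h0 : G₂ 0 = 0) {ε : ℝ} (hε : 0 < ε) (hε' : G₁ ε < 0)
    {D : ℝ} (hD : 0 < D) (hl₁ : ∃ R, ∀ a, R ≤ a → D * a ≤ G₁ a)
    (hl₂ : ∃ R, ∀ a, R ≤ a → D * a ≤ G₂ a) :
    ∃ a b, 0 < a ∧ 0 < b ∧ G₁ a = D * b ∧ G₂ b = D * a := by
  obtain ⟨R₁, hR₁⟩ := hl₁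
  obtain ⟨R₂, hR₂⟩ := hl₂
  set R := max ε (max R₁ R₂)
  have hεR : ε ≤ R := le_max_left _ _
  -- The unknown b = G₁(a)/D is eliminated. The truncation at 0 keeps the argument of G₂ in [0, ∞),
  -- where continuity is known, and makes the value at ε equal to -Dε < 0.
  have hcont : ContinuousOn (fun a => G₂ (max (G₁ a) 0 / D) - D * a) (Icc ε R) := by
    have hsub : Icc ε R ⊆ Ici 0 := fun a ha => hε.le.trans ha.1
    refine ContinuousOn.sub (h₂.comp (((h₁.mono hsub).sup continuousOn_const).div_const D) ?_)
      (by fun_prop)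
    intro a _
    exact div_nonneg (le_max_right _ _) hD.le
  have hRge : R ≤ max (G₁ R) 0 / D := by
    rw [le_div_iff₀ hD, mul_comm]
    exact (hR₁ R ((le_max_left _ _).trans (le_max_right _ _))).trans (le_max_left _ _)
  have hmem : (0 : ℝ) ∈ Icc (G₂ (max (G₁ ε) 0 / D) - D * ε) (G₂ (max (G₁ R) 0 / D) - D * R) := by
    constructor
    · rw [max_eq_right hε'.le, zero_div, h0]; nlinarith
    · have h3 := hR₂ _ (((le_max_right _ _).trans (le_max_right _ _)).trans hRge)
      have h4 := mul_le_mul_of_nonneg_left hRge hD.le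
      linarith
  obtain ⟨a, ha, hae⟩ := intermediate_value_Icc hεR hcont hmem
  have hapos : 0 < a := hε.trans_le ha.1
  -- At a root the truncation is inactive: otherwise the equation would read -Da = 0.
  have hG : 0 < G₁ a := by
    by_contra hneg
    simp only [max_eq_right (not_lt.mp hneg), zero_div, h0] at hae
    nlinarith
  simp only [max_eq_left hG.le] at hae
  exact ⟨a, G₁ a / D, hapos, by positivity, by field_simp, by linarith⟩

/-! ### The nonlinearity along a ray. -/

/-- The hypotheses on the nonlinearity in the form in which they are used. -/
structure Superlinear {N : ℕ} (Ω : Set (EuclideanSpace ℝ (Fin N)))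
    (f : EuclideanSpace ℝ (Fin N) → ℝ → ℝ) : Prop where
  cont : Continuous (Function.uncurry f)
  small : ∀ ε : ℝ, 0 < ε → ∃ δ : ℝ, 0 < δ ∧
      ∀ᵐ x ∂(volume.restrict Ω), ∀ t : ℝ, t ≠ 0 → |t| < δ → |f x t / t| < ε
  pos : ∀ᵐ x ∂(volume.restrict Ω), ∀ t : ℝ, t ≠ 0 → 0 < f x t * t
  mono : ∀ᵐ x ∂(volume.restrict Ω),
      MonotoneOn (fun t : ℝ => f x t / t) (Set.Ioi 0) ∧
      AntitoneOn (fun t : ℝ => f x t / t) (Set.Iio 0)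

section

variable {N : ℕ} {Ω : Set (EuclideanSpace ℝ (Fin N))} {f : EuclideanSpace ℝ (Fin N) → ℝ → ℝ}
  {ψ : EuclideanSpace ℝ (Fin N) → ℝ}

/-- Since ψ vanishes off Ω, the integral may be taken over the compact closure, where continuity in
the parameter is automatic. -/
theorem continuous_setIntegral_comp_mul (hb : Bornology.IsBounded Ω)
    (hf : Continuous (Function.uncurry f)) (hψ : Continuous ψ) (hψ0 : ∀ x ∉ Ω, ψ x = 0) :
    Continuous fun a : ℝ => ∫ x in Ω, f x (a * ψ x) * ψ x := by
  have h1 : ∀ a : ℝ, ∫ x in Ω, f x (a * ψ x) * ψ x = ∫ x in closure Ω, f x (a * ψ x) * ψ x :=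
    fun a => (setIntegral_eq_of_subset_of_forall_sdiff_eq_zero measurableSet_closure subset_closure
      fun x hx => by simp [hψ0 x hx.2]).symm
  simp only [h1]
  refine continuous_parametric_integral_of_continuous (μ := volume) ?_ hb.isCompact_closure
  exact (hf.comp (by fun_prop : Continuous fun z : ℝ × EuclideanSpace ℝ (Fin N) =>
    (z.2, z.1 * ψ z.2))).mul (by fun_prop)

theorem integrableOn_of_continuous (hb : Bornology.IsBounded Ω) {g : EuclideanSpace ℝ (Fin N) → ℝ}
    (hg : Continuous g) : IntegrableOn g Ω volume :=
  (hg.continuousOn.integrableOn_compact hb.isCompact_closure).mono_set subset_closure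

theorem setIntegral_comp_mul_nonneg (hf : Superlinear Ω f) (a : ℝ) :
    0 ≤ ∫ x in Ω, f x (a * ψ x) * (a * ψ x) := by
  refine integral_nonneg_of_ae ?_
  filter_upwards [hf.pos] with x hx
  rcases eq_or_ne (a * ψ x) 0 with h | h
  · simp [h]
  · exact (hx _ h).le

theorem setIntegral_pos_of_ball_subset {c : EuclideanSpace ℝ (Fin N)} {ρ : ℝ} (hρ : 0 < ρ)
    (hball : Metric.ball c ρ ⊆ Ω) {g : EuclideanSpace ℝ (Fin N) → ℝ}
    (hg : IntegrableOn g Ω volume) (hg0 : 0 ≤ᵐ[volume.restrict Ω] g)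
    (hpos : ∀ᵐ x ∂(volume.restrict Ω), x ∈ Metric.ball c ρ → 0 < g x) : 0 < ∫ x in Ω, g x := by
  rw [integral_pos_iff_support_of_nonneg_ae hg0 hg]
  refine (Metric.measure_ball_pos volume c hρ).trans_le ?_
  rw [← inter_eq_self_of_subset_left hball, ← Measure.restrict_apply measurableSet_ball]
  refine measure_mono_ae ?_
  filter_upwards [hpos] with x hx hxb
  exact (hx hxb).ne'

/-- Pointwise f(x,t)t = (f(x,t)/t) t², and both nonnegative factors grow with |t| on either side of
0. -/
theorem setIntegral_comp_mul_mono (hb : Bornology.IsBounded Ω) (hf : Superlinear Ω f)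
    (hψ : Continuous ψ) {a b : ℝ} (ha : 0 < a) (hab : a ≤ b) :
    ∫ x in Ω, f x (a * ψ x) * (a * ψ x) ≤ ∫ x in Ω, f x (b * ψ x) * (b * ψ x) := by
  have hb0 : 0 < b := ha.trans_le hab
  have hint : ∀ a : ℝ, IntegrableOn (fun x => f x (a * ψ x) * (a * ψ x)) Ω volume := fun a =>
    integrableOn_of_continuous hb ((hf.cont.comp (by fun_prop :
      Continuous fun x => (x, a * ψ x))).mul (by fun_prop))
  refine integral_mono_ae (hint a) (hint b) ?_
  filter_upwards [hf.pos, hf.mono] with x hx hm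
  rcases eq_or_ne (ψ x) 0 with h | h
  · simp [h]
  have hq : f x (a * ψ x) / (a * ψ x) ≤ f x (b * ψ x) / (b * ψ x) := by
    rcases lt_or_gt_of_ne h with h | h
    · exact hm.2 (mul_neg_of_pos_of_neg hb0 h) (mul_neg_of_pos_of_neg ha h)
        (mul_le_mul_of_nonpos_right hab h.le)
    · exact hm.1 (mul_pos ha h) (mul_pos hb0 h) (mul_le_mul_of_nonneg_right hab h.le)
  have hconv : ∀ t : ℝ, t ≠ 0 → f x t * t = f x t / t * t ^ 2 := fun t ht => by field_simp
  have ha' : a * ψ x ≠ 0 := mul_ne_zero ha.ne' h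
  have hb' : b * ψ x ≠ 0 := mul_ne_zero hb0.ne' h
  rw [hconv _ ha', hconv _ hb']
  have h0 : 0 ≤ f x (b * ψ x) / (b * ψ x) := by
    have h3 := hx _ hb'
    rw [hconv _ hb'] at h3
    exact (pos_of_mul_pos_left h3 (sq_nonneg _)).le
  refine mul_le_mul hq ?_ (sq_nonneg _) h0
  rw [mul_pow, mul_pow]
  gcongr

/-- Near zero the lower-order integral is negligible against any positive quadratic term. -/
theorem exists_setIntegral_comp_mul_le (hb : Bornology.IsBounded Ω) (hf : Superlinear Ω f)
    (hψ : Continuous ψ) {κ : ℝ} (hκ : 0 < κ) :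
    ∃ δ > 0, ∀ a, 0 < a → a < δ → ∫ x in Ω, f x (a * ψ x) * ψ x ≤ κ * a := by
  obtain ⟨M, hM⟩ := hb.isCompact_closure.exists_bound_of_continuousOn hψ.continuousOn
  set B := ∫ x in Ω, ψ x ^ 2
  have hB : 0 ≤ B := integral_nonneg fun x => sq_nonneg _
  -- For small a the integrand is at most κ/(B+1) · aψ², whose integral is κaB/(B+1) ≤ κa. The added
  -- 1 avoids a case distinction on B = 0.
  obtain ⟨δ, hδ, hs⟩ := hf.small (κ / (B + 1)) (by positivity)
  refine ⟨δ / (|M| + 1), by positivity, fun a ha haδ => ?_⟩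
  rw [lt_div_iff₀ (by positivity)] at haδ
  have hi : IntegrableOn (fun x => f x (a * ψ x) * ψ x) Ω volume :=
    integrableOn_of_continuous hb ((hf.cont.comp (by fun_prop :
      Continuous fun x => (x, a * ψ x))).mul (by fun_prop))
  have hi2 : IntegrableOn (fun x => κ / (B + 1) * a * ψ x ^ 2) Ω volume :=
    integrableOn_of_continuous hb (by fun_prop)
  have hle : ∫ x in Ω, f x (a * ψ x) * ψ x ≤ ∫ x in Ω, κ / (B + 1) * a * ψ x ^ 2 := by
    refine integral_mono_ae hi hi2 ?_
    have hmem : ∀ᵐ x ∂(volume.restrict Ω), x ∈ closure Ω :=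
      (ae_restrict_mem measurableSet_closure).filter_mono
        (ae_mono (Measure.restrict_mono subset_closure le_rfl))
    filter_upwards [hs, hmem] with x hx hxΩ
    rcases eq_or_ne (ψ x) 0 with h | h
    · simp [h]
    have h1 : |a * ψ x| < δ := by
      rw [abs_mul, abs_of_pos ha]
      refine lt_of_le_of_lt (mul_le_mul_of_nonneg_left ?_ ha.le) haδ
      have := hM x hxΩ
      rw [Real.norm_eq_abs] at this
      linarith [le_abs_self M]
    have h2 := (le_abs_self _).trans (hx _ (mul_ne_zero ha.ne' h) h1).le
    have h3 : f x (a * ψ x) * ψ x = f x (a * ψ x) / (a * ψ x) * (a * ψ x ^ 2) := by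
      field_simp
    rw [h3, mul_assoc (κ / (B + 1))]
    gcongr
  rw [integral_const_mul] at hle
  refine hle.trans ?_
  rw [div_mul_eq_mul_div, div_mul_eq_mul_div, div_le_iff₀ (by positivity)]
  nlinarith [mul_pos hκ ha]

end

theorem eq_zero_of_abs_div_lt {g : ℝ → ℝ} (hg : Continuous g) {C δ : ℝ} (hδ : 0 < δ)
    (h : ∀ t, t ≠ 0 → |t| < δ → |g t / t| < C) : g 0 = 0 := by
  have h1 : Tendsto g (𝓝[≠] 0) (𝓝 (g 0)) := hg.continuousAt.mono_left nhdsWithin_le_nhds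
  have h2 : Tendsto (fun t : ℝ => C * |t|) (𝓝[≠] 0) (𝓝 0) := by
    have : Continuous fun t : ℝ => C * |t| := by fun_prop
    simpa using (this.tendsto 0).mono_left nhdsWithin_le_nhds
  refine tendsto_nhds_unique h1 (squeeze_zero_norm' ?_ h2)
  have h3 : ∀ᶠ t : ℝ in 𝓝[≠] 0, |t| < δ := by
    have : ∀ᶠ t : ℝ in 𝓝 0, |t| < δ :=
      (continuous_abs.tendsto' 0 0 abs_zero).eventually (gt_mem_nhds hδ)
    exact this.filter_mono nhdsWithin_le_nhds
  filter_upwards [h3, self_mem_nhdsWithin] with t ht ht0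
  have := (h t ht0 ht).le
  rwa [abs_div, div_le_iff₀ (abs_pos.mpr ht0)] at this

/-- The condition on f(x,t)/t excludes t = 0; it forces f(x,t) → 0 as t → 0, and continuity then
gives the value there. -/
theorem Superlinear.apply_zero {N : ℕ} {Ω : Set (EuclideanSpace ℝ (Fin N))}
    {f : EuclideanSpace ℝ (Fin N) → ℝ → ℝ} (hf : Superlinear Ω f) :
    ∀ᵐ x ∂(volume.restrict Ω), f x 0 = 0 := by
  obtain ⟨δ, hδ, h⟩ := hf.small 1 one_pos
  filter_upwards [h] with x hx
  exact eq_zero_of_abs_div_lt (hf.cont.comp (by fun_prop : Continuous fun t : ℝ => (x, t))) hδ hx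

/-- Along the ray through `ψ`, the derivative of the energy in direction `ψ`, with reversed sign. -/
noncomputable def rayFun {N : ℕ} (s : ℝ) (Ω : Set (EuclideanSpace ℝ (Fin N)))
    (f : EuclideanSpace ℝ (Fin N) → ℝ → ℝ) (lam : ℝ) (ψ : EuclideanSpace ℝ (Fin N) → ℝ)
    (a : ℝ) : ℝ :=
  (∫ x in Ω, |ψ x| ^ critExp N s) * a ^ (critExp N s - 1) +
    lam * (∫ x in Ω, f x (a * ψ x) * ψ x) - gagliardoInner s ψ ψ * a

section

variable {N : ℕ} {s : ℝ} {Ω : Set (EuclideanSpace ℝ (Fin N))}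
  {f : EuclideanSpace ℝ (Fin N) → ℝ → ℝ} {lam : ℝ} {ψ : EuclideanSpace ℝ (Fin N) → ℝ}

theorem continuousOn_rayFun (hs0 : 0 < s) (hsN : 2 * s < (N : ℝ)) (hb : Bornology.IsBounded Ω)
    (hf : Continuous (Function.uncurry f)) (hψ : Continuous ψ) (hψ0 : ∀ x ∉ Ω, ψ x = 0) :
    ContinuousOn (rayFun s Ω f lam ψ) (Ici 0) := by
  have hp2 := two_lt_critExp hs0 hsN
  have h1 : Continuous fun a : ℝ => a ^ (critExp N s - 1) :=
    Real.continuous_rpow_const (by linarith)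
  have h2 := continuous_setIntegral_comp_mul hb hf hψ hψ0
  exact (((continuous_const.mul h1).add (continuous_const.mul h2)).sub
    (continuous_const.mul continuous_id)).continuousOn

theorem rayFun_zero (hs0 : 0 < s) (hsN : 2 * s < (N : ℝ)) (hf : Superlinear Ω f) :
    rayFun s Ω f lam ψ 0 = 0 := by
  have hp2 := two_lt_critExp hs0 hsN
  have h1 : ∫ x in Ω, f x 0 * ψ x = 0 := by
    refine integral_eq_zero_of_ae ?_
    filter_upwards [hf.apply_zero] with x hx
    simp [hx]
  simp [rayFun, h1, Real.zero_rpow (by linarith : critExp N s - 1 ≠ 0)]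

/-- Translates `rayFun` back to the Nehari equation, from which it arises by division by a. -/
theorem mul_rayFun (hs0 : 0 < s) (hsN : 2 * s < (N : ℝ)) {a : ℝ} (ha : 0 < a) :
    a * rayFun s Ω f lam ψ a = a ^ critExp N s * (∫ x in Ω, |ψ x| ^ critExp N s) +
      lam * (∫ x in Ω, f x (a * ψ x) * (a * ψ x)) - a ^ 2 * gagliardoInner s ψ ψ := by
  have h1 : ∫ x in Ω, f x (a * ψ x) * (a * ψ x) = a * ∫ x in Ω, f x (a * ψ x) * ψ x := by
    rw [← integral_const_mul]
    simp only [mul_left_comm]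
  have h2 : a ^ critExp N s = a * a ^ (critExp N s - 1) := by
    rw [← Real.rpow_one_add' ha.le (by linarith [two_lt_critExp hs0 hsN])]; congr 1; ring
  rw [h1, h2, rayFun]; ring

theorem exists_rayFun_neg (hs0 : 0 < s) (hsN : 2 * s < (N : ℝ)) (hb : Bornology.IsBounded Ω)
    (hf : Superlinear Ω f) (hlam : 0 < lam) (hψ : Continuous ψ)
    (hA : 0 < gagliardoInner s ψ ψ) : ∃ ε > 0, rayFun s Ω f lam ψ ε < 0 := by
  have hp2 := two_lt_critExp hs0 hsN
  set A := gagliardoInner s ψ ψ with hAdef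
  set P := ∫ x in Ω, |ψ x| ^ critExp N s with hP
  have hP0 : 0 ≤ P := integral_nonneg fun x => Real.rpow_nonneg (abs_nonneg _) _
  -- Half of the quadratic term absorbs the lower-order integral; the other half strictly dominates
  -- the critical term, as p > 2.
  obtain ⟨δ, hδ, h⟩ := exists_setIntegral_comp_mul_le hb hf hψ (κ := A / (2 * lam)) (by positivity)
  have hlim : Tendsto (fun a : ℝ => P * a ^ (critExp N s - 2)) (𝓝[>] 0) (𝓝 0) := by
    have hc : Continuous fun a : ℝ => P * a ^ (critExp N s - 2) :=
      continuous_const.mul (Real.continuous_rpow_const (by linarith))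
    have := hc.tendsto 0
    rw [Real.zero_rpow (by linarith), mul_zero] at this
    exact this.mono_left nhdsWithin_le_nhds
  have hev : ∀ᶠ a : ℝ in 𝓝[>] 0, P * a ^ (critExp N s - 2) < A / 2 :=
    hlim.eventually (gt_mem_nhds (half_pos hA))
  obtain ⟨a, ha, ha0, haδ⟩ := (hev.and (Ioo_mem_nhdsGT hδ)).exists
  refine ⟨a, ha0, ?_⟩
  have h1 := mul_le_mul_of_nonneg_left (h a ha0 haδ) hlam.le
  have h2 : lam * (A / (2 * lam) * a) = A / 2 * a := by field_simp
  have h3 : a ^ (critExp N s - 1) = a ^ (critExp N s - 2) * a := by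
    rw [← Real.rpow_add_one ha0.ne']; congr 1; ring
  have h4 := mul_lt_mul_of_pos_right ha ha0
  rw [rayFun, ← hAdef, ← hP, h3]
  rw [h2] at h1
  nlinarith

/-- The critical power alone outgrows every linear term; the lower-order integral is nonnegative and
is discarded. -/
theorem exists_forall_mul_le_rayFun (hs0 : 0 < s) (hsN : 2 * s < (N : ℝ)) (hf : Superlinear Ω f)
    (hlam : 0 < lam) (hP : 0 < ∫ x in Ω, |ψ x| ^ critExp N s) {D : ℝ} :
    ∃ R, ∀ a, R ≤ a → D * a ≤ rayFun s Ω f lam ψ a := by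
  have hp2 := two_lt_critExp hs0 hsN
  set A := gagliardoInner s ψ ψ with hAdef
  set P := ∫ x in Ω, |ψ x| ^ critExp N s with hPdef
  have hlim : Tendsto (fun a : ℝ => P * a ^ (critExp N s - 2)) atTop atTop :=
    (tendsto_rpow_atTop (by linarith)).const_mul_atTop hP
  obtain ⟨R, hR⟩ := eventually_atTop.mp
    ((hlim.eventually_ge_atTop (A + D)).and (eventually_gt_atTop 0))
  refine ⟨R, fun a ha => ?_⟩
  obtain ⟨h1, ha0⟩ := hR a ha
  have h2 := mul_rayFun (Ω := Ω) (f := f) (lam := lam) (ψ := ψ) hs0 hsN ha0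
  have h3 := mul_nonneg hlam.le (setIntegral_comp_mul_nonneg (ψ := ψ) hf a)
  have h4 : a ^ critExp N s = a ^ (critExp N s - 2) * a ^ 2 := by
    rw [← Real.rpow_natCast, ← Real.rpow_add ha0]; congr 1; push_cast; ring
  rw [← hAdef, ← hPdef, h4] at h2
  refine le_of_mul_le_mul_left ?_ ha0
  rw [h2]
  nlinarith [mul_le_mul_of_nonneg_right h1 (sq_nonneg a)]

theorem gagliardoInner_pos_of_prod {u v : EuclideanSpace ℝ (Fin N) → ℝ}
    {S T : Set (EuclideanSpace ℝ (Fin N))}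
    (hi : Integrable (gagliardoIntegrand s u v) volume) (h0 : 0 ≤ gagliardoIntegrand s u v)
    (hS : volume S ≠ 0) (hT : volume T ≠ 0)
    (hpos : ∀ x ∈ S, ∀ y ∈ T, gagliardoIntegrand s u v (x, y) ≠ 0) :
    0 < gagliardoInner s u v := by
  rw [gagliardoInner, integral_pos_iff_support_of_nonneg h0 hi]
  refine lt_of_lt_of_le ?_ (measure_mono (s := S ×ˢ T) fun z hz => hpos z.1 hz.1 z.2 hz.2)
  rw [Measure.volume_eq_prod, Measure.prod_prod]
  positivity

theorem setIntegral_comp_mul_pos (hb : Bornology.IsBounded Ω) (hf : Superlinear Ω f) (hψ : Continuous ψ)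
    (hball : ∃ c ρ, 0 < ρ ∧ Metric.ball c ρ ⊆ Ω ∧ ∀ x ∈ Metric.ball c ρ, ψ x ≠ 0)
    {a : ℝ} (ha : 0 < a) :
    0 < ∫ x in Ω, f x (a * ψ x) * (a * ψ x) := by
  obtain ⟨c, ρ, hρ, hsub, hc⟩ := hball
  refine setIntegral_pos_of_ball_subset hρ hsub (integrableOn_of_continuous hb
    ((hf.cont.comp (by fun_prop : Continuous fun x => (x, a * ψ x))).mul (by fun_prop))) ?_ ?_
  · filter_upwards [hf.pos] with x hx
    rcases eq_or_ne (a * ψ x) 0 with h | h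
    · simp [h]
    · exact (hx _ h).le
  · filter_upwards [hf.pos] with x hx hxb
    exact hx _ (mul_ne_zero ha.ne' (hc x hxb))

theorem gagliardoInner_comm (u v : EuclideanSpace ℝ (Fin N) → ℝ) :
    gagliardoInner s u v = gagliardoInner s v u := by
  simp only [gagliardoInner, gagliardoIntegrand, mul_comm]

theorem not_ae_eq_zero
    (hball : ∃ c ρ, 0 < ρ ∧ Metric.ball c ρ ⊆ Ω ∧ ∀ x ∈ Metric.ball c ρ, ψ x ≠ 0)
    {a : ℝ} (ha : 0 < a) : ¬ ((fun x => a * ψ x) =ᵐ[volume] 0) := by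
  obtain ⟨c, ρ, hρ, -, hc⟩ := hball
  intro h
  refine (Metric.measure_ball_pos volume c hρ).ne' (measure_mono_null (fun x hx => ?_) h)
  exact mul_ne_zero ha.ne' (hc x hx)

end

/-! ### Bump pairs and points of the nodal Nehari set. -/

/-- Admissible pairs of test functions: nonzero bumps in `Ω` of opposite sign with disjoint
supports. -/
structure BumpPair {N : ℕ} (s : ℝ) (Ω : Set (EuclideanSpace ℝ (Fin N)))
    (ψ χ : EuclideanSpace ℝ (Fin N) → ℝ) : Prop where
  mem₁ : ψ ∈ fracSobolev N s
  mem₂ : χ ∈ fracSobolev N s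
  cont₁ : Continuous ψ
  cont₂ : Continuous χ
  zero₁ : ∀ x ∉ Ω, ψ x = 0
  zero₂ : ∀ x ∉ Ω, χ x = 0
  nonneg : ∀ x, 0 ≤ ψ x
  nonpos : ∀ x, χ x ≤ 0
  disj : ∀ x, ψ x = 0 ∨ χ x = 0
  ball₁ : ∃ c ρ, 0 < ρ ∧ Metric.ball c ρ ⊆ Ω ∧ ∀ x ∈ Metric.ball c ρ, ψ x ≠ 0
  ball₂ : ∃ c ρ, 0 < ρ ∧ Metric.ball c ρ ⊆ Ω ∧ ∀ x ∈ Metric.ball c ρ, χ x ≠ 0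

theorem exists_bumpPair {N : ℕ} {s : ℝ} (hs0 : 0 < s) (hs1 : s < 1) (hsN : 2 * s < (N : ℝ))
    {Ω : Set (EuclideanSpace ℝ (Fin N))} (hΩ : IsOpen Ω) (hne : Ω.Nonempty) :
    ∃ ψ χ, BumpPair s Ω ψ χ := by
  have hN' : (0 : ℝ) < N := by linarith
  have hN : 0 < N := by exact_mod_cast hN'
  have : Nonempty (Fin N) := ⟨⟨0, hN⟩⟩
  obtain ⟨c, hc⟩ := hne
  obtain ⟨r, hr, hball⟩ := Metric.isOpen_iff.mp hΩ c hc
  -- Two balls of radius r/4 with centres r/2 apart are disjoint, and both lie in the ball of radius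
  -- r around c.
  obtain ⟨v, hv⟩ := exists_norm_eq (EuclideanSpace ℝ (Fin N)) (half_pos hr).le
  have hd : dist (c + v) c = r / 2 := by simp [dist_eq_norm, hv]
  have hb1 : Metric.ball c (r / 4) ⊆ Ω :=
    (Metric.ball_subset_ball (by linarith)).trans hball
  have hb2 : Metric.ball (c + v) (r / 4) ⊆ Ω :=
    (Metric.ball_subset_ball' (by rw [hd]; linarith)).trans hball
  have h2 := tent_mem_fracSobolev hs0 hs1 hN (c + v) (ρ := r / 4) (by positivity)
  refine ⟨tent c (r / 4), fun x => -tent (c + v) (r / 4) x,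
    { mem₁ := tent_mem_fracSobolev hs0 hs1 hN c (by positivity)
      mem₂ := ⟨h2.1.neg, h2.2.congr (Eventually.of_forall fun z => ?_)⟩
      cont₁ := continuous_tent _ _
      cont₂ := (continuous_tent _ _).neg
      zero₁ := fun x hx => tent_eq_zero fun h => hx (hb1 h)
      zero₂ := fun x hx => by rw [tent_eq_zero fun h => hx (hb2 h), neg_zero]
      nonneg := tent_nonneg _ _
      nonpos := fun x => neg_nonpos.mpr (tent_nonneg _ _ x)
      disj := fun x => ?_
      ball₁ := ⟨c, r / 4, by positivity, hb1, fun x hx => (tent_pos_iff.mpr hx).ne'⟩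
      ball₂ := ⟨c + v, r / 4, by positivity, hb2, fun x hx =>
        neg_ne_zero.mpr (tent_pos_iff.mpr hx).ne'⟩ }⟩
  · simp only [gagliardoIntegrand]; ring
  · by_cases hx : x ∈ Metric.ball c (r / 4)
    · right
      rw [tent_eq_zero, neg_zero]
      intro hx'
      rw [Metric.mem_ball] at hx hx'
      have := dist_triangle_left (c + v) c x
      linarith
    · exact Or.inl (tent_eq_zero hx)

namespace BumpPair

variable {N : ℕ} {s : ℝ} {Ω : Set (EuclideanSpace ℝ (Fin N))}
  {f : EuclideanSpace ℝ (Fin N) → ℝ → ℝ} {lam : ℝ} {ψ χ : EuclideanSpace ℝ (Fin N) → ℝ}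

/-- Transfers to χ what is proved for the first member of a pair. -/
theorem symm_neg (h : BumpPair s Ω ψ χ) : BumpPair s Ω (fun x => -χ x) (fun x => -ψ x) where
  mem₁ := ⟨h.mem₂.1.neg, h.mem₂.2.congr (Eventually.of_forall fun z => by
    simp only [gagliardoIntegrand]; ring)⟩
  mem₂ := ⟨h.mem₁.1.neg, h.mem₁.2.congr (Eventually.of_forall fun z => by
    simp only [gagliardoIntegrand]; ring)⟩
  cont₁ := h.cont₂.neg
  cont₂ := h.cont₁.neg
  zero₁ x hx := by rw [h.zero₂ x hx, neg_zero]
  zero₂ x hx := by rw [h.zero₁ x hx, neg_zero]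
  nonneg x := neg_nonneg.mpr (h.nonpos x)
  nonpos x := neg_nonpos.mpr (h.nonneg x)
  disj x := by simpa using (h.disj x).symm
  ball₁ := by simpa using h.ball₂
  ball₂ := by simpa using h.ball₁

/-- ψ is nonzero on one ball and zero on the other, so the integrand is nonzero on their product, a
set of positive measure. -/
theorem gagliardoInner_self_pos (h : BumpPair s Ω ψ χ) : 0 < gagliardoInner s ψ ψ := by
  obtain ⟨c, ρ, hρ, -, hc⟩ := h.ball₁
  obtain ⟨d, σ, hσ, -, hd⟩ := h.ball₂
  refine gagliardoInner_pos_of_prod h.mem₁.2 (gagliardoIntegrand_self_nonneg s ψ)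
    (Metric.measure_ball_pos volume c hρ).ne' (Metric.measure_ball_pos volume d hσ).ne'
    fun x hx y hy => ?_
  have hx' := hc x hx
  have hy' := (h.disj y).resolve_right (hd y hy)
  have hxy : x - y ≠ 0 := sub_ne_zero.mpr fun e => hx' (e ▸ hy')
  have : 0 < ‖x - y‖ := norm_pos_iff.mpr hxy
  simp only [gagliardoIntegrand, hy', sub_zero]
  positivity

/-- By disjointness the numerator is -χ(x)ψ(y) - χ(y)ψ(x), which is nonnegative because the signs
are opposite. -/
theorem gagliardoInner_cross_pos (h : BumpPair s Ω ψ χ) : 0 < gagliardoInner s χ ψ := by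
  obtain ⟨c, ρ, hρ, -, hc⟩ := h.ball₁
  obtain ⟨d, σ, hσ, -, hd⟩ := h.ball₂
  refine gagliardoInner_pos_of_prod (integrable_gagliardoIntegrand h.mem₂ h.mem₁) (fun z => ?_)
    (Metric.measure_ball_pos volume c hρ).ne' (Metric.measure_ball_pos volume d hσ).ne'
    fun x hx y hy => ?_
  · refine div_nonneg ?_ (Real.rpow_nonneg (norm_nonneg _) _)
    have h1 := h.nonneg z.1
    have h2 := h.nonneg z.2
    have h3 := h.nonpos z.1
    have h4 := h.nonpos z.2
    rcases h.disj z.1 with e1 | e1 <;> rcases h.disj z.2 with e2 | e2 <;> rw [e1, e2] <;> nlinarith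
  · have hx' := hc x hx
    have hy' := (h.disj y).resolve_right (hd y hy)
    have hx'' := (h.disj x).resolve_left hx'
    have hxy : x - y ≠ 0 := sub_ne_zero.mpr fun e => hx' (e ▸ hy')
    have : 0 < ‖x - y‖ := norm_pos_iff.mpr hxy
    have hy'' := hd y hy
    simp only [gagliardoIntegrand, hy', hx'', sub_zero, zero_sub]
    have : 0 < ‖x - y‖ ^ ((N : ℝ) + 2 * s) := by positivity
    exact div_ne_zero (mul_ne_zero (neg_ne_zero.mpr hy'') hx') this.ne'

theorem setIntegral_rpow_pos (hs0 : 0 < s) (hsN : 2 * s < (N : ℝ)) (hb : Bornology.IsBounded Ω)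
    (h : BumpPair s Ω ψ χ) : 0 < ∫ x in Ω, |ψ x| ^ critExp N s := by
  obtain ⟨c, ρ, hρ, hsub, hc⟩ := h.ball₁
  have hp2 := two_lt_critExp hs0 hsN
  refine setIntegral_pos_of_ball_subset hρ hsub (integrableOn_of_continuous hb
    (h.cont₁.abs.rpow_const fun _ => Or.inr (by linarith)))
    (Eventually.of_forall fun x => Real.rpow_nonneg (abs_nonneg _) _)
    (Eventually.of_forall fun x hx => ?_)
  have := hc x hx
  positivity

theorem posP_eq (h : BumpPair s Ω ψ χ) {a b : ℝ} (ha : 0 < a) (hb : 0 < b) :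
    posP (fun x => a * ψ x + b * χ x) = fun x => a * ψ x := by
  funext x
  have h1 := mul_nonneg ha.le (h.nonneg x)
  have h2 := mul_nonpos_of_nonneg_of_nonpos hb.le (h.nonpos x)
  rcases h.disj x with e | e <;> simp only [posP, e, mul_zero, zero_add, add_zero]
  · exact max_eq_right h2
  · exact max_eq_left h1

theorem negP_eq (h : BumpPair s Ω ψ χ) {a b : ℝ} (ha : 0 < a) (hb : 0 < b) :
    negP (fun x => a * ψ x + b * χ x) = fun x => b * χ x := by
  funext x
  have h1 := mul_nonneg ha.le (h.nonneg x)
  have h2 := mul_nonpos_of_nonneg_of_nonpos hb.le (h.nonpos x)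
  rcases h.disj x with e | e <;> simp only [negP, e, mul_zero, zero_add, add_zero]
  · exact min_eq_left h2
  · exact min_eq_right h1

theorem smul_add_smul_mem_fracSobolev (h : BumpPair s Ω ψ χ) (a b : ℝ) :
    (fun x => a * ψ x + b * χ x) ∈ fracSobolev N s := by
  refine ⟨(h.mem₁.1.const_mul a).add (h.mem₂.1.const_mul b), ?_⟩
  refine (((h.mem₁.2.const_mul (a ^ 2)).add
    ((integrable_gagliardoIntegrand h.mem₁ h.mem₂).const_mul (2 * a * b))).add
    (h.mem₂.2.const_mul (b ^ 2))).congr (Eventually.of_forall fun z => ?_)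
  simp only [gagliardoIntegrand, Pi.add_apply]
  ring

theorem gagliardoInner_smul_add_smul (h : BumpPair s Ω ψ χ) (a b : ℝ) :
    gagliardoInner s (fun x => a * ψ x + b * χ x) (fun x => a * ψ x + b * χ x) =
      a ^ 2 * gagliardoInner s ψ ψ + 2 * a * b * gagliardoInner s χ ψ +
        b ^ 2 * gagliardoInner s χ χ := by
  simp only [gagliardoInner]
  have h1 := h.mem₁.2.const_mul (a ^ 2)
  have h2 := (integrable_gagliardoIntegrand h.mem₂ h.mem₁).const_mul (2 * a * b)
  rw [← integral_const_mul, ← integral_const_mul, ← integral_const_mul, ← integral_add' h1 h2,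
    ← integral_add' (h1.add h2) (h.mem₂.2.const_mul (b ^ 2))]
  refine integral_congr_ae (Eventually.of_forall fun z => ?_)
  simp only [gagliardoIntegrand, Pi.add_apply]
  ring

/-- Some positive combination of the two bumps lies in the nodal Nehari set. -/
theorem exists_mem_nodalNehari (hs0 : 0 < s) (hsN : 2 * s < (N : ℝ)) (hΩ : MeasurableSet Ω)
    (hb : Bornology.IsBounded Ω)
    (hf : Superlinear Ω f) (hlam : 0 < lam) (h : BumpPair s Ω ψ χ) :
    ∃ a b : ℝ, 0 < a ∧ 0 < b ∧ (fun x => a * ψ x + b * χ x) ∈ nodalNehari s Ω f lam ∧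
      a ^ 2 * gagliardoInner s ψ ψ + a * b * gagliardoInner s χ ψ =
        a ^ critExp N s * (∫ x in Ω, |ψ x| ^ critExp N s) +
          lam * ∫ x in Ω, f x (a * ψ x) * (a * ψ x) ∧
      b ^ 2 * gagliardoInner s χ χ + a * b * gagliardoInner s χ ψ =
        b ^ critExp N s * (∫ x in Ω, |χ x| ^ critExp N s) +
          lam * ∫ x in Ω, f x (b * χ x) * (b * χ x) := by
  have hPχ : 0 < ∫ x in Ω, |χ x| ^ critExp N s := by
    simpa only [abs_neg] using h.symm_neg.setIntegral_rpow_pos hs0 hsN hb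
  obtain ⟨ε, hε, hneg⟩ := exists_rayFun_neg hs0 hsN hb hf hlam h.cont₁ h.gagliardoInner_self_pos
  obtain ⟨a, b, ha, hb0, e1, e2⟩ := exists_pos_coupled
    (continuousOn_rayFun (lam := lam) hs0 hsN hb hf.cont h.cont₁ h.zero₁)
    (continuousOn_rayFun (lam := lam) hs0 hsN hb hf.cont h.cont₂ h.zero₂) (rayFun_zero hs0 hsN hf)
    hε hneg h.gagliardoInner_cross_pos
    (exists_forall_mul_le_rayFun hs0 hsN hf hlam (h.setIntegral_rpow_pos hs0 hsN hb))
    (exists_forall_mul_le_rayFun hs0 hsN hf hlam hPχ)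
  have m1 := mul_rayFun (Ω := Ω) (f := f) (lam := lam) (ψ := ψ) hs0 hsN ha
  have m2 := mul_rayFun (Ω := Ω) (f := f) (lam := lam) (ψ := χ) hs0 hsN hb0
  rw [e1] at m1
  rw [e2] at m2
  refine ⟨a, b, ha, hb0, ⟨⟨h.smul_add_smul_mem_fracSobolev a b, ?_⟩, ?_, ?_, ?_, ?_⟩,
    by linarith, by linarith⟩
  · refine ae_restrict_of_forall_mem hΩ.compl fun x hx => ?_
    simp only [h.zero₁ x hx, h.zero₂ x hx, mul_zero, add_zero]
  · rw [h.posP_eq ha hb0, energyDeriv_smul_add_smul hs0 hsN Ω f lam h.mem₁ h.mem₂ h.disj ha b]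
    linarith
  · have hcomm : (fun x => a * ψ x + b * χ x) = fun x => b * χ x + a * ψ x := by
      funext x; ring
    rw [h.negP_eq ha hb0, hcomm, energyDeriv_smul_add_smul hs0 hsN Ω f lam h.mem₂ h.mem₁
      (fun x => (h.disj x).symm) hb0 a, gagliardoInner_comm ψ χ]
    linarith
  · rw [h.posP_eq ha hb0]; exact not_ae_eq_zero h.ball₁ ha
  · rw [h.negP_eq ha hb0]; exact not_ae_eq_zero h.ball₂ hb0

end BumpPair

/-! ### The limit of large λ. -/

theorem energy_le_half_gagliardoInner {N : ℕ} {s : ℝ} (hs0 : 0 < s) (hsN : 2 * s < (N : ℝ))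
    {Ω : Set (EuclideanSpace ℝ (Fin N))} {f : EuclideanSpace ℝ (Fin N) → ℝ → ℝ}
    (hF : ∀ᵐ x ∂(volume.restrict Ω), ∀ t, 0 ≤ primitiveF f x t) {lam : ℝ} (hlam : 0 ≤ lam)
    (u : EuclideanSpace ℝ (Fin N) → ℝ) :
    energy s Ω f lam u ≤ 1 / 2 * gagliardoInner s u u := by
  have hp2 := two_lt_critExp hs0 hsN
  have h1 : 0 ≤ ∫ x in Ω, |u x| ^ critExp N s :=
    integral_nonneg fun x => Real.rpow_nonneg (abs_nonneg _) _
  have h2 : 0 ≤ ∫ x in Ω, primitiveF f x (u x) := by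
    refine integral_nonneg_of_ae ?_
    filter_upwards [hF] with x hx using hx _
  have h3 : 0 ≤ 1 / critExp N s := by positivity
  have h4 := mul_nonneg h3 h1
  have h5 := mul_nonneg hlam h2
  unfold energy
  linarith

/-- A priori bound for positive solutions of the coupled equations: they stay in a box on which
the superlinear lower-order terms are controlled uniformly in the parameter. -/
theorem exists_bound_of_coupled {p A B D P Q : ℝ} (hp : 2 < p) (hA : 0 < A) (hB : 0 < B)
    (hD : 0 < D) (hP : 0 < P) (hQ : 0 < Q) :
    ∃ M, 0 ≤ M ∧ ∀ a b H₁ H₂ : ℝ, 0 < a → 0 < b → 0 ≤ H₁ → 0 ≤ H₂ →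
      a ^ 2 * A + a * b * D = a ^ p * P + H₁ → b ^ 2 * B + a * b * D = b ^ p * Q + H₂ →
      H₁ ≤ M ∧ H₂ ≤ M := by
  set C := A + 2 * D + B with hC
  have hCpos : 0 < C := by positivity
  set c := min P Q with hc
  have hcpos : 0 < c := lt_min hP hQ
  -- Adding the equations and dropping H₁, H₂ gives c m^p ≤ C m² for m = max(a, b), that is m ≤ R.
  -- The sum then also gives H₁, H₂ ≤ C m² ≤ C R².
  set R := (C / c) ^ (1 / (p - 2)) with hR
  have hRpos : 0 < R := by positivity
  refine ⟨C * R ^ 2, by positivity, fun a b H₁ H₂ ha hb h1 h2 e1 e2 => ?_⟩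
  set m := max a b with hm
  have ham : a ≤ m := le_max_left _ _
  have hbm : b ≤ m := le_max_right _ _
  have hmpos : 0 < m := ha.trans_le ham
  have hlhs : a ^ 2 * A + 2 * (a * b) * D + b ^ 2 * B ≤ C * m ^ 2 := by
    have i1 : a ^ 2 ≤ m ^ 2 := by gcongr
    have i2 : b ^ 2 ≤ m ^ 2 := by gcongr
    have i3 : a * b ≤ m ^ 2 := by rw [sq]; gcongr
    have j1 := mul_le_mul_of_nonneg_right i1 hA.le
    have j2 := mul_le_mul_of_nonneg_right i2 hB.le
    have j3 := mul_le_mul_of_nonneg_right i3 hD.le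
    rw [hC]; linarith
  have hap : 0 ≤ a ^ p * P := by positivity
  have hbq : 0 ≤ b ^ p * Q := by positivity
  have hmp : c * m ^ p ≤ a ^ p * P + b ^ p * Q := by
    rcases max_choice a b with h | h
    · have : c * m ^ p ≤ P * a ^ p := by
        rw [hm, h]; gcongr; exact min_le_left _ _
      linarith
    · have : c * m ^ p ≤ Q * b ^ p := by
        rw [hm, h]; gcongr; exact min_le_right _ _
      linarith
  have hmp2 : m ^ p = m ^ (p - 2) * m ^ 2 := by
    rw [← Real.rpow_natCast m 2, ← Real.rpow_add hmpos]; congr 1; push_cast; ring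
  have hmR : m ≤ R := by
    rw [hR, one_div, Real.le_rpow_inv_iff_of_pos hmpos.le (by positivity) (by linarith),
      le_div_iff₀ hcpos]
    refine le_of_mul_le_mul_right ?_ (pow_pos hmpos 2)
    rw [hmp2] at hmp
    linarith
  have hfin : C * m ^ 2 ≤ C * R ^ 2 := by gcongr
  constructor <;> linarith

theorem tendsto_nodalLevel {N : ℕ} {s : ℝ} (hs0 : 0 < s) (hsN : 2 * s < (N : ℝ))
    {Ω : Set (EuclideanSpace ℝ (Fin N))} (hΩ : MeasurableSet Ω) (hb : Bornology.IsBounded Ω)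
    {f : EuclideanSpace ℝ (Fin N) → ℝ → ℝ} (hf : Superlinear Ω f)
    (hF : ∀ᵐ x ∂(volume.restrict Ω), ∀ t, 0 ≤ primitiveF f x t)
    {ψ χ : EuclideanSpace ℝ (Fin N) → ℝ} (h : BumpPair s Ω ψ χ)
    (hnonneg : ∀ lam, 0 < lam → ∀ u ∈ nodalNehari s Ω f lam, 0 ≤ energy s Ω f lam u) :
    Tendsto (fun lam : ℝ => nodalLevel s Ω f lam) atTop (𝓝 0) := by
  have hPχ : 0 < ∫ x in Ω, |χ x| ^ critExp N s := by
    simpa only [abs_neg] using h.symm_neg.setIntegral_rpow_pos hs0 hsN hb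
  have hBpos : 0 < gagliardoInner s χ χ := by
    have h1 := h.symm_neg.gagliardoInner_self_pos
    have h2 : gagliardoInner s (fun x => -χ x) (fun x => -χ x) = gagliardoInner s χ χ := by
      simp only [gagliardoInner, gagliardoIntegrand]
      congr 1; funext z; ring
    rwa [h2] at h1
  obtain ⟨M, hM, hbound⟩ := exists_bound_of_coupled (two_lt_critExp hs0 hsN)
    h.gagliardoInner_self_pos hBpos h.gagliardoInner_cross_pos
    (h.setIntegral_rpow_pos hs0 hsN hb) hPχ
  set C := gagliardoInner s ψ ψ + 2 * gagliardoInner s χ ψ + gagliardoInner s χ χ with hC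
  have hCpos : 0 < C := by
    have := h.gagliardoInner_self_pos
    have := h.gagliardoInner_cross_pos
    positivity
  have hsmall : ∀ ε, 0 < ε → ∃ Λ, 0 < Λ ∧ ∀ lam, Λ ≤ lam →
      nodalLevel s Ω f lam ≤ 1 / 2 * (C * ε ^ 2) := by
    intro ε hε
    set k₁ := ∫ x in Ω, f x (ε * ψ x) * (ε * ψ x) with hk₁
    set k₂ := ∫ x in Ω, f x (ε * χ x) * (ε * χ x) with hk₂
    have hk₁pos : 0 < k₁ := setIntegral_comp_mul_pos hb hf h.cont₁ h.ball₁ hε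
    have hk₂pos : 0 < k₂ := setIntegral_comp_mul_pos hb hf h.cont₂ h.ball₂ hε
    -- If a > ε, monotonicity would give λk₁ ≤ λ∫f(x,aψ)aψ ≤ M, whereas this threshold forces λk₁ ≥
    -- M + 1. The same applies to b and k₂.
    refine ⟨(M + 1) / min k₁ k₂, by positivity, fun lam hlam => ?_⟩
    have hmin : 0 < min k₁ k₂ := lt_min hk₁pos hk₂pos
    have hlam0 : 0 < lam := lt_of_lt_of_le (by positivity) hlam
    rw [div_le_iff₀ hmin] at hlam
    obtain ⟨a, b, ha, hb0, hmem, e1, e2⟩ := h.exists_mem_nodalNehari hs0 hsN hΩ hb hf hlam0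
    obtain ⟨b1, b2⟩ := hbound a b _ _ ha hb0
      (mul_nonneg hlam0.le (setIntegral_comp_mul_nonneg (ψ := ψ) hf a))
      (mul_nonneg hlam0.le (setIntegral_comp_mul_nonneg (ψ := χ) hf b)) e1 e2
    have haε : a ≤ ε := by
      by_contra! hcon
      have h1 := setIntegral_comp_mul_mono hb hf h.cont₁ hε hcon.le
      have h2 := mul_le_mul_of_nonneg_left ((min_le_left k₁ k₂).trans h1) hlam0.le
      linarith
    have hbε : b ≤ ε := by
      by_contra! hcon
      have h1 := setIntegral_comp_mul_mono hb hf h.cont₂ hε hcon.le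
      have h2 := mul_le_mul_of_nonneg_left ((min_le_right k₁ k₂).trans h1) hlam0.le
      linarith
    have hle : nodalLevel s Ω f lam ≤ energy s Ω f lam (fun x => a * ψ x + b * χ x) :=
      csInf_le ⟨0, by rintro _ ⟨u, hu, rfl⟩; exact hnonneg lam hlam0 u hu⟩ ⟨_, hmem, rfl⟩
    refine hle.trans ((energy_le_half_gagliardoInner hs0 hsN hF hlam0.le _).trans ?_)
    rw [h.gagliardoInner_smul_add_smul a b]
    have i1 : a ^ 2 ≤ ε ^ 2 := by gcongr
    have i2 : b ^ 2 ≤ ε ^ 2 := by gcongr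
    have i3 : a * b ≤ ε ^ 2 := by rw [sq]; gcongr
    have j1 := mul_le_mul_of_nonneg_right i1 h.gagliardoInner_self_pos.le
    have j2 := mul_le_mul_of_nonneg_right i2 hBpos.le
    have j3 := mul_le_mul_of_nonneg_right i3 h.gagliardoInner_cross_pos.le
    rw [hC]; linarith
  rw [Metric.tendsto_atTop]
  intro η hη
  -- With this ε the upper bound ½Cε² equals η/2.
  obtain ⟨Λ, hΛ, hle⟩ := hsmall (Real.sqrt (η / C)) (by positivity)
  refine ⟨Λ, fun lam hlam => ?_⟩
  have h1 := hle lam hlam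
  rw [Real.sq_sqrt (by positivity), mul_div_cancel₀ _ hCpos.ne'] at h1
  have h2 : 0 ≤ nodalLevel s Ω f lam :=
    Real.sInf_nonneg (by rintro _ ⟨u, hu, rfl⟩; exact hnonneg lam (hΛ.trans_le hlam) u hu)
  rw [Real.dist_eq, sub_zero, abs_of_nonneg h2]
  linarith

/-! ### Replacing f by a globally continuous function, and conclusion. -/

theorem energy_congr {N : ℕ} {s : ℝ} {Ω : Set (EuclideanSpace ℝ (Fin N))} (hΩ : MeasurableSet Ω)
    {f g : EuclideanSpace ℝ (Fin N) → ℝ → ℝ} (hfg : ∀ x ∈ Ω, f x = g x) :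
    energy s Ω f = energy s Ω g := by
  funext lam u
  have : ∫ x in Ω, primitiveF f x (u x) = ∫ x in Ω, primitiveF g x (u x) :=
    setIntegral_congr_fun hΩ fun x hx => by simp only [primitiveF, hfg x hx]
  rw [energy, energy, this]

theorem energyDeriv_congr {N : ℕ} {s : ℝ} {Ω : Set (EuclideanSpace ℝ (Fin N))}
    (hΩ : MeasurableSet Ω) {f g : EuclideanSpace ℝ (Fin N) → ℝ → ℝ} (hfg : ∀ x ∈ Ω, f x = g x) :
    energyDeriv s Ω f = energyDeriv s Ω g := by
  funext lam u v
  have : ∫ x in Ω, f x (u x) * v x = ∫ x in Ω, g x (u x) * v x :=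
    setIntegral_congr_fun hΩ fun x hx => by simp only [hfg x hx]
  rw [energyDeriv, energyDeriv, this]

/-- Tietze extension. The original f is continuous only over the closure of Ω, while the earlier
arguments compose it with functions on the whole space; energy, derivative and level depend only on
its values over Ω. -/
theorem exists_continuous_extension {X : Type*} [TopologicalSpace X] [NormalSpace (X × ℝ)]
    {K : Set X} (hK : IsClosed K) {f : X → ℝ → ℝ}
    (hf : ContinuousOn (Function.uncurry f) (K ×ˢ (univ : Set ℝ))) :
    ∃ g : X → ℝ → ℝ, Continuous (Function.uncurry g) ∧ ∀ x ∈ K, f x = g x := by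
  obtain ⟨G, hG⟩ := ContinuousMap.exists_restrict_eq (hK.prod isClosed_univ)
    ⟨(K ×ˢ (univ : Set ℝ)).domRestrict (Function.uncurry f), hf.domRestrict⟩
  refine ⟨fun x t => G (x, t), G.continuous, fun x hx => funext fun t => ?_⟩
  exact (DFunLike.congr_fun hG ⟨(x, t), hx, mem_univ t⟩).symm

/-- The mean value inequality gives |g(t)t| ≤ c(|t|² + |t|^q), and each power is at most 1 + |t|^p.
This growth bound makes f(x,u)u integrable. -/
theorem abs_mul_self_le_of_abs_deriv_le {g : ℝ → ℝ} (hg : Differentiable ℝ g) (h0 : g 0 = 0)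
    {c q p : ℝ} (hc : 0 ≤ c) (hq : 2 < q) (hqp : q ≤ p)
    (h : ∀ t, |deriv g t| ≤ c * (1 + |t| ^ (q - 2))) (t : ℝ) :
    |g t * t| ≤ 2 * c * (1 + |t| ^ p) := by
  have h1 := Convex.norm_image_sub_le_of_norm_deriv_le (f := g) (s := Metric.closedBall 0 |t|)
    (x := 0) (y := t) (C := c * (1 + |t| ^ (q - 2))) (fun x _ => hg x) (fun x hx => by
      rw [mem_closedBall_zero_iff, Real.norm_eq_abs] at hx
      rw [Real.norm_eq_abs]
      refine (h x).trans ?_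
      gcongr) (convex_closedBall _ _) (Metric.mem_closedBall_self (abs_nonneg t)) (by simp)
  rw [h0, sub_zero, sub_zero, Real.norm_eq_abs, Real.norm_eq_abs] at h1
  have hr : ∀ r, 0 ≤ r → r ≤ p → |t| ^ r ≤ 1 + |t| ^ p := by
    intro r hr0 hrp
    rcases le_total |t| 1 with ht | ht
    · have := Real.rpow_le_one (abs_nonneg t) ht hr0
      have : 0 ≤ |t| ^ p := by positivity
      linarith
    · linarith [Real.rpow_le_rpow_of_exponent_le ht hrp]
  have h2 := hr 2 (by norm_num) (by linarith)
  have h3 := hr q (by linarith) hqp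
  have h4 : |t| ^ (q - 2) * |t| * |t| = |t| ^ q := by
    have := abs_rpow_sub_two_mul_mul_self (t := |t|) hq
    rwa [abs_abs] at this
  rw [Real.rpow_two] at h2
  rw [abs_mul]
  calc |g t| * |t| ≤ c * (1 + |t| ^ (q - 2)) * |t| * |t| := by gcongr
    _ = c * (|t| ^ 2 + |t| ^ (q - 2) * |t| * |t|) := by ring
    _ ≤ c * ((1 + |t| ^ p) + (1 + |t| ^ p)) := by rw [h4]; gcongr
    _ = _ := by ring

theorem proposition1 {N : ℕ} (s : ℝ) (hs0 : 0 < s) (hs1 : s < 1) (hsN : 2 * s < (N : ℝ))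
    (Ω : Set (EuclideanSpace ℝ (Fin N))) (hΩ : IsSmoothBoundedDomain Ω)
    (f : EuclideanSpace ℝ (Fin N) → ℝ → ℝ)
    (hf_cont : ContinuousOn (Function.uncurry f) (closure Ω ×ˢ (Set.univ : Set ℝ)))
    (hf_diff : ∀ᵐ x ∂(volume.restrict Ω), ContDiff ℝ 1 (f x))
    (hH1 : ∃ q : ℝ, 2 < q ∧ q < critExp N s ∧ ∃ c₁ : ℝ, 0 < c₁ ∧
      ∀ᵐ x ∂(volume.restrict Ω), ∀ t : ℝ, |deriv (f x) t| ≤ c₁ * (1 + |t| ^ (q - 2)))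
    (hH2 : ∀ ε : ℝ, 0 < ε → ∃ δ : ℝ, 0 < δ ∧
      ∀ᵐ x ∂(volume.restrict Ω), ∀ t : ℝ, t ≠ 0 → |t| < δ → |f x t / t| < ε)
    (hH3 : ∃ μ : ℝ, 2 < μ ∧ μ < critExp N s ∧
      ∀ᵐ x ∂(volume.restrict Ω), ∀ t : ℝ, t ≠ 0 →
        0 < μ * primitiveF f x t ∧ μ * primitiveF f x t ≤ t * f x t)
    (hH4 : ∀ᵐ x ∂(volume.restrict Ω),
      MonotoneOn (fun t : ℝ => f x t / t) (Set.Ioi 0) ∧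
      AntitoneOn (fun t : ℝ => f x t / t) (Set.Iio 0)) :
    (∀ lam : ℝ, 0 < lam →
      (nodalNehari s Ω f lam).Nonempty ∧
      BddBelow (energy s Ω f lam '' nodalNehari s Ω f lam)) ∧
    Tendsto (fun lam : ℝ => nodalLevel s Ω f lam) atTop (𝓝 0) := by
  obtain ⟨g, hg, hfg⟩ := exists_continuous_extension isClosed_closure hf_cont
  have hm : MeasurableSet Ω := hΩ.isOpen.measurableSet
  have hb := hΩ.isBounded
  have hfg' : ∀ x ∈ Ω, f x = g x := fun x hx => hfg x (subset_closure hx)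
  have hae : ∀ᵐ x ∂(volume.restrict Ω), g x = f x :=
    ae_restrict_of_forall_mem hm fun x hx => (hfg' x hx).symm
  have hE : energy s Ω f = energy s Ω g := energy_congr hm hfg'
  have hN : nodalNehari s Ω f = nodalNehari s Ω g := by
    funext lam
    simp only [nodalNehari, energyDeriv_congr hm hfg']
  have hL : nodalLevel s Ω f = nodalLevel s Ω g := by
    funext lam
    simp only [nodalLevel, hE, hN]
  obtain ⟨μ, hμ, -, hAR⟩ := hH3
  have hF : ∀ᵐ x ∂(volume.restrict Ω), ∀ t, 0 ≤ primitiveF g x t ∧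
      2 * primitiveF g x t ≤ t * g x t := by
    filter_upwards [hAR, hae] with x hx hgx t
    have hp : primitiveF g x t = primitiveF f x t := by simp only [primitiveF, hgx]
    rw [hp, hgx]
    rcases eq_or_ne t 0 with rfl | ht
    · simp [primitiveF]
    · obtain ⟨h1, h2⟩ := hx t ht
      have h3 := pos_of_mul_pos_right h1 (by linarith)
      exact ⟨h3.le, (mul_le_mul_of_nonneg_right hμ.le h3.le).trans h2⟩
  have hS : Superlinear Ω g := by
    refine ⟨hg, fun ε hε => ?_, ?_, ?_⟩
    · obtain ⟨δ, hδ, h⟩ := hH2 ε hε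
      refine ⟨δ, hδ, ?_⟩
      filter_upwards [h, hae] with x hx hgx
      rwa [hgx]
    · filter_upwards [hAR, hae] with x hx hgx t ht
      rw [hgx, mul_comm]
      exact (hx t ht).1.trans_le (hx t ht).2
    · filter_upwards [hH4, hae] with x hx hgx
      rwa [hgx]
  obtain ⟨q, hq, hqp, c, hc, hder⟩ := hH1
  have hgrow : ∀ᵐ x ∂(volume.restrict Ω), ∀ t,
      |g x t * t| ≤ 2 * c * (1 + |t| ^ critExp N s) := by
    filter_upwards [hder, hf_diff, hS.apply_zero, hae] with x hx hd h0 hgx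
    rw [hgx] at h0 ⊢
    exact abs_mul_self_le_of_abs_deriv_le (hd.differentiable one_ne_zero) h0 hc.le hq hqp.le hx
  have hnonneg : ∀ lam, 0 < lam → ∀ u ∈ nodalNehari s Ω g lam, 0 ≤ energy s Ω g lam u :=
    fun lam hlam u hu => energy_nonneg_of_mem_nodalNehari hs0 hsN hb hg hgrow hF hlam.le hu
  obtain ⟨ψ, χ, h⟩ := exists_bumpPair hs0 hs1 hsN hΩ.isOpen hΩ.isConnected.nonempty
  rw [hL, hN, hE]
  refine ⟨fun lam hlam => ⟨?_, 0, ?_⟩,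
    tendsto_nodalLevel hs0 hsN hm hb hS (hF.mono fun x hx t => (hx t).1) h hnonneg⟩
  · obtain ⟨a, b, -, -, hmem, -⟩ := h.exists_mem_nodalNehari hs0 hsN hm hb hS hlam
    exact ⟨_, hmem⟩
  · rintro _ ⟨u, hu, rfl⟩
    exact hnonneg lam hlam u hu
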